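/- For $L\ge 1$ let $Q_Lf$ be the polynomial of degree at most $L$ that interpolates $f:[0,2]\to\mathbb C$ at the nodes $1+\cos(\ell\pi/L)$, $\ell=0,\dots,L$, and for $z\in\mathbb C$ put $$I_z(f)=\int_0^2 f(s)e^{zs}\,ds,\qquad I_{L,z}(f)=\int_0^2 (Q_Lf)(s)e^{zs}\,ds.$$ For an integer $m\ge1$ let $\varrho_m(s)=(s(2-s))^{m-1/2}$ and $\|g\|_{\varrho_m}=\big(\int_0^2|g(s)|^2\varrho_m(s)\,ds\big)^{1/2}$. Let $X_m$ be the set of all continuous $f:[0,2]\to\mathbb C$ that are $m-1$ times continuously differentiable in $(0,2)$, with $f^{(m-1)}$ locally absolutely continuous in $(0,2)$ and $\|f^{(m)}\|_{\varrho_m}<\infty$. (i) For all $\mu_0>0$ and all integers $m\ge1$ there is a constant $C_{m,\mu_0}>0$ such that for all integers $L\ge\max\{1,m-1\}$, all $z\in\mathbb C$ with $\sigma:=\operatorname{Re}z\le\mu_0$ and all $f\in X_m$, $$|I_{L,z}(f)-I_z(f)|\le C_{m,\mu_0}\,L^{1-m}(1+|\sigma|)^{-3/4}\min\Big\{\frac1L,\frac{(1+|\sigma|)^{1/2}}{|z|}\Big\}\,\|f^{(m)}\|_{\varrho_m},$$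 where for $z=0$ the minimum is read as $1/L$. (ii) For all $\mu_0>0$, all integers $m$ and all real $m_0$ with $m\ge m_0>7/2$ there is a constant $C'_{m,m_0,\mu_0}>0$ such that for all integers $L\ge m-1$, all $z\in\mathbb C$ with $\sigma:=\operatorname{Re}z\le\mu_0$ and all $f\in X_m$, $$|I_{L,z}(f)-I_z(f)|\le C'_{m,m_0,\mu_0}\,(1+|z|)^{-2}L^{m_0-m-1}\big(1+(1+|\sigma|)^{-1/2}L\big)\,\|f^{(m)}\|_{\varrho_m}.$$ -/

import Mathlib

open MeasureTheory Set

namespace ClenshawCurtis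

noncomputable section

/-- The shifted Chebyshev nodes `1 + cos (ℓ π / L)` on `[0, 2]`, for `ℓ = 0, …, L`. -/
def node (L ℓ : ℕ) : ℝ := 1 + Real.cos (ℓ * Real.pi / L)

/-- The polynomial `Q_L f` of degree at most `L` that interpolates `f` at the `L + 1` shifted
Chebyshev nodes (for `L ≥ 1`). -/
def interp (L : ℕ) (f : ℝ → ℂ) : Polynomial ℂ :=
  Lagrange.interpolate (Finset.range (L + 1)) (fun ℓ => (node L ℓ : ℂ)) (fun ℓ => f (node L ℓ))

/-- `I_z(f) = ∫₀² f(s) exp(s z) ds`. -/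
def exactInt (z : ℂ) (f : ℝ → ℂ) : ℂ :=
  ∫ s in (0 : ℝ)..2, f s * Complex.exp (s * z)

/-- The product Clenshaw–Curtis rule `I_{L,z}(f) = ∫₀² (Q_L f)(s) exp(s z) ds`. -/
def rule (L : ℕ) (z : ℂ) (f : ℝ → ℂ) : ℂ :=
  ∫ s in (0 : ℝ)..2, (interp L f).eval (s : ℂ) * Complex.exp (s * z)

/-- The weight `ϱ_m(s) = (s (2 - s))^(m - 1/2)`, used for `0 < s < 2`. -/
def weight (m : ℕ) (s : ℝ) : ℝ := (s * (2 - s)) ^ ((m : ℝ) - 1 / 2)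

/-- The weighted norm `‖g‖_{ϱ_m} = (∫₀² |g(s)|² ϱ_m(s) ds)^(1/2)`
(meaningful when the integrand is integrable). -/
def weightedNorm (m : ℕ) (g : ℝ → ℂ) : ℝ :=
  Real.sqrt (∫ s in Ioo (0 : ℝ) 2, ‖g s‖ ^ 2 * weight m s)

/-- The functions for which `‖f^(m)‖_{ϱ_m}` makes sense and is finite (`m ≥ 1`): `f` is continuous
on `[0, 2]`, it is `m - 1` times continuously differentiable in `(0, 2)` with `f^(m-1)` locally
absolutely continuous there, so that `f^(m)` exists almost everywhere (and is the `m`-th weak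
derivative of `f`), and `|f^(m)|² ϱ_m` is integrable over `(0, 2)`. Nothing is required of the
derivatives at the endpoints. -/
structure IsAdmissible (m : ℕ) (f : ℝ → ℂ) : Prop where
  continuousOn : ContinuousOn f (Icc 0 2)
  contDiffOn : ContDiffOn ℝ ((m - 1 : ℕ) : WithTop ℕ∞) f (Ioo 0 2)
  absCont : ∀ a b : ℝ, 0 < a → a ≤ b → b < 2 →
    AbsolutelyContinuousOnInterval (iteratedDeriv (m - 1) f) a b
  integrable : IntegrableOn (fun s => ‖iteratedDeriv m f s‖ ^ 2 * weight m s) (Ioo 0 2)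

end

end ClenshawCurtis

/-!
Put `s = 1 + cos θ`. Interpolation at the nodes sends `T_n` to some `T_k` with `k ≤ L` (aliasing),
so the quadrature error of a Chebyshev series only involves the differences `T_k - T_n` with
`n > L`. Orthogonality of the Gegenbauer polynomials makes the weighted norm of the `m`-th
derivative diagonal in the Chebyshev coefficients, with weights `∏_{j < m} (n² - j²)`, of order
`n^(2m)`. Cauchy–Schwarz against these weights bounds the norms of the interpolation error and of
its derivative, while `∫ exp (-κ (1 + cos θ)) dθ` decays like `κ^(-1/2)`, and with an additional
factor `sin² θ` like `κ^(-3/2)`. The interpolation error vanishes at both endpoints, so one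
integration by parts gains `1 / |z|`; two integrations by parts, applied to each `T_k - T_n`, gain
`|z|^(-2)`.

This settles polynomials. An admissible function is approximated by dilating it towards the midpoint
of `[0, 2]`, approximating the `m`-th derivative by polynomials in `L²`, and integrating back; both
sides of the estimates pass to the limit.
-/

namespace ClenshawCurtis

open Polynomial

noncomputable section

/-! ### Chebyshev series and Gegenbauer norms -/

/-- The Gegenbauer bilinear form `∫₀^π p(cos θ) q(cos θ) sin^{2m} θ dθ`, for which the `m`-th
derivatives of the Chebyshev polynomials are orthogonal. It is bilinear rather than sesquilinear, so
that integration by parts needs no conjugation. -/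
def gegenbauerForm (m : ℕ) (p q : ℂ[X]) : ℂ :=
  ∫ θ in (0 : ℝ)..Real.pi,
    p.eval (Real.cos θ : ℂ) * q.eval (Real.cos θ : ℂ) * (Real.sin θ : ℂ) ^ (2 * m)

/-- The Gegenbauer norm `(∫₀^π |p(cos θ)|² sin^{2m} θ dθ)^(1/2)`. Under `s = 1 + cos θ` it is the
norm `‖·‖_{ϱ_m}` of the shifted polynomial. -/
def gegenbauerNorm (m : ℕ) (p : ℂ[X]) : ℝ :=
  √(∫ θ in (0 : ℝ)..Real.pi, ‖p.eval (Real.cos θ : ℂ)‖ ^ 2 * Real.sin θ ^ (2 * m))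

/-- The finite Chebyshev series with coefficients `a` over the index set `s`. -/
def chebSum (s : Finset ℕ) (a : ℕ → ℂ) : ℂ[X] := ∑ n ∈ s, C (a n) * Chebyshev.T ℂ n

/-- The squared norm of the Chebyshev polynomial `T_n` for the Chebyshev weight. -/
def chebNormSq (n : ℕ) : ℝ := if n = 0 then Real.pi else Real.pi / 2

lemma sq_gegenbauerNorm (m : ℕ) (p : ℂ[X]) :
    gegenbauerNorm m p ^ 2 =
      ∫ θ in (0 : ℝ)..Real.pi, ‖p.eval (Real.cos θ : ℂ)‖ ^ 2 * Real.sin θ ^ (2 * m) :=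
  Real.sq_sqrt <| intervalIntegral.integral_nonneg Real.pi_pos.le fun θ _ => by
    rw [pow_mul]
    positivity

lemma hasDerivAt_eval_cos (p : ℂ[X]) (θ : ℝ) :
    HasDerivAt (fun θ : ℝ => p.eval (Real.cos θ : ℂ))
      (-(derivative p).eval (Real.cos θ : ℂ) * (Real.sin θ : ℂ)) θ := by
  have hcos : HasDerivAt (fun θ : ℝ => (Real.cos θ : ℂ)) ((-Real.sin θ : ℝ) : ℂ) θ :=
    (Real.hasDerivAt_cos θ).ofReal_comp
  simpa [Function.comp_def] using (p.hasDerivAt (Real.cos θ : ℂ)).comp θ hcos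

-- The derivative is the difference of the two integrands in `gegenbauerForm_succ_derivative`.
lemma hasDerivAt_mul_iterate_derivative_T_mul_sin_pow (m n : ℕ) (p : ℂ[X]) (θ : ℝ) :
    HasDerivAt
      (fun θ : ℝ => p.eval (Real.cos θ : ℂ) *
        ((derivative^[m + 1] (Chebyshev.T ℂ n)).eval (Real.cos θ : ℂ) *
          (Real.sin θ : ℂ) ^ (2 * m + 1)))
      (((n : ℂ) ^ 2 - (m : ℂ) ^ 2) * (p.eval (Real.cos θ : ℂ) *
          (derivative^[m] (Chebyshev.T ℂ n)).eval (Real.cos θ : ℂ) * (Real.sin θ : ℂ) ^ (2 * m)) -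
        (derivative p).eval (Real.cos θ : ℂ) *
          (derivative^[m + 1] (Chebyshev.T ℂ n)).eval (Real.cos θ : ℂ) *
          (Real.sin θ : ℂ) ^ (2 * (m + 1))) θ := by
  have hsin : HasDerivAt (fun θ : ℝ => (Real.sin θ : ℂ)) ((Real.cos θ : ℝ) : ℂ) θ :=
    (Real.hasDerivAt_sin θ).ofReal_comp
  refine ((hasDerivAt_eval_cos p θ).mul
    ((hasDerivAt_eval_cos (derivative^[m + 1] (Chebyshev.T ℂ n)) θ).mul
      (hsin.pow (2 * m + 1)))).congr_deriv ?_
  have hode := Chebyshev.one_sub_X_sq_mul_iterate_derivative_T_eval (R := ℂ) n m (Real.cos θ)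
  have hsq : (Real.sin θ : ℂ) ^ 2 = 1 - (Real.cos θ : ℂ) ^ 2 := by
    exact_mod_cast congrArg Complex.ofReal (Real.sin_sq θ)
  rw [← hsq] at hode
  simp only [Pi.mul_apply, Pi.pow_apply, ← Function.iterate_succ_apply' derivative]
  push_cast at hode ⊢
  rw [mul_add, pow_add, pow_succ, pow_mul]
  linear_combination (-(eval (Complex.cos θ) p) * (Complex.sin θ ^ 2) ^ m) * hode

lemma gegenbauerForm_succ_derivative (m n : ℕ) (p : ℂ[X]) :
    gegenbauerForm (m + 1) (derivative p) (derivative^[m + 1] (Chebyshev.T ℂ n)) =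
      ((n : ℂ) ^ 2 - (m : ℂ) ^ 2) * gegenbauerForm m p (derivative^[m] (Chebyshev.T ℂ n)) := by
  have hparts := intervalIntegral.integral_eq_sub_of_hasDerivAt
    (fun θ (_ : θ ∈ uIcc 0 Real.pi) => hasDerivAt_mul_iterate_derivative_T_mul_sin_pow m n p θ)
    (Continuous.intervalIntegrable (by fun_prop) _ _)
  rw [intervalIntegral.integral_sub (Continuous.intervalIntegrable (by fun_prop) _ _)
    (Continuous.intervalIntegrable (by fun_prop) _ _),
    intervalIntegral.integral_const_mul] at hparts
  refine (sub_eq_zero.mp (hparts.trans ?_)).symm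
  simp

lemma gegenbauerForm_iterate_derivative (m n : ℕ) (p : ℂ[X]) :
    gegenbauerForm m (derivative^[m] p) (derivative^[m] (Chebyshev.T ℂ n)) =
      (∏ j ∈ Finset.range m, ((n : ℂ) ^ 2 - (j : ℂ) ^ 2)) *
        gegenbauerForm 0 p (Chebyshev.T ℂ n) := by
  induction m with
  | zero => simp
  | succ m ih =>
    rw [Function.iterate_succ_apply' derivative m p, gegenbauerForm_succ_derivative, ih,
      Finset.prod_range_succ]
    ring

lemma chebNormSq_le (n : ℕ) : chebNormSq n ≤ Real.pi := by
  unfold chebNormSq; split_ifs <;> linarith [Real.pi_pos]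

lemma one_le_chebNormSq (n : ℕ) : 1 ≤ chebNormSq n := by
  unfold chebNormSq; split_ifs <;> linarith [Real.pi_gt_three]

lemma gegenbauerForm_zero_T_T (k n : ℕ) :
    gegenbauerForm 0 (Chebyshev.T ℂ k) (Chebyshev.T ℂ n) =
      if k = n then (chebNormSq n : ℂ) else 0 := by
  have hreal : gegenbauerForm 0 (Chebyshev.T ℂ k) (Chebyshev.T ℂ n) =
      ((∫ x, (Chebyshev.T ℝ k).eval x * (Chebyshev.T ℝ n).eval x ∂Chebyshev.measureT : ℝ) : ℂ) := by
    rw [Chebyshev.integral_measureT_eq_integral_cos, ← intervalIntegral.integral_ofReal]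
    simp only [gegenbauerForm, mul_zero, pow_zero, mul_one]
    refine intervalIntegral.integral_congr fun θ _ => ?_
    simp only [← Chebyshev.complex_ofReal_eval_T]
    push_cast
    rfl
  rw [hreal]
  split_ifs with hkn
  · subst hkn
    rcases eq_or_ne k 0 with rfl | hk
    · simpa [chebNormSq] using Chebyshev.integral_eval_T_real_mul_self_measureT_zero
    · rw [Chebyshev.integral_T_real_mul_self_measureT_of_ne_zero hk]
      simp [chebNormSq, hk]
  · rw [Chebyshev.integral_eval_T_real_mul_eval_T_real_measureT_of_ne hkn]
    simp

lemma gegenbauerForm_comm (m : ℕ) (p q : ℂ[X]) : gegenbauerForm m p q = gegenbauerForm m q p :=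
  intervalIntegral.integral_congr fun θ _ => by ring

lemma gegenbauerForm_sum_left {ι : Type*} (m : ℕ) (s : Finset ι) (a : ι → ℂ) (p : ι → ℂ[X])
    (q : ℂ[X]) :
    gegenbauerForm m (∑ i ∈ s, C (a i) * p i) q = ∑ i ∈ s, a i * gegenbauerForm m (p i) q := by
  simp only [gegenbauerForm, ← intervalIntegral.integral_const_mul]
  rw [← intervalIntegral.integral_finsetSum
    fun i _ => Continuous.intervalIntegrable (by fun_prop) _ _]
  refine intervalIntegral.integral_congr fun θ _ => ?_
  simp only [eval_finsetSum, eval_mul, eval_C, Finset.sum_mul]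
  exact Finset.sum_congr rfl fun i _ => by ring

lemma iterate_derivative_sum_C_mul {R ι : Type*} [CommSemiring R] (m : ℕ) (s : Finset ι)
    (a : ι → R) (p : ι → R[X]) :
    derivative^[m] (∑ i ∈ s, C (a i) * p i) = ∑ i ∈ s, C (a i) * derivative^[m] (p i) := by
  simp only [iterate_derivative_sum, iterate_derivative_C_mul]

lemma conj_eval_iterate_derivative_chebSum (m : ℕ) (s : Finset ℕ) (a : ℕ → ℂ) (x : ℝ) :
    starRingEnd ℂ ((derivative^[m] (chebSum s a)).eval (x : ℂ)) =
      (derivative^[m] (chebSum s (fun n => starRingEnd ℂ (a n)))).eval (x : ℂ) := by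
  have hmap : chebSum s (fun n => starRingEnd ℂ (a n)) = (chebSum s a).map (starRingEnd ℂ) := by
    simp [chebSum, Polynomial.map_sum]
  rw [hmap, iterate_derivative_map, eval_map, ← Complex.conj_ofReal x, eval₂_at_apply,
    Complex.conj_ofReal]

theorem sq_gegenbauerNorm_iterate_derivative_chebSum (m : ℕ) (s : Finset ℕ) (a : ℕ → ℂ) :
    gegenbauerNorm m (derivative^[m] (chebSum s a)) ^ 2 =
      ∑ n ∈ s, ‖a n‖ ^ 2 *
        ((∏ j ∈ Finset.range m, ((n : ℝ) ^ 2 - (j : ℝ) ^ 2)) * chebNormSq n) := by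
  have hform : ((gegenbauerNorm m (derivative^[m] (chebSum s a)) ^ 2 : ℝ) : ℂ) =
      gegenbauerForm m (derivative^[m] (chebSum s a))
        (derivative^[m] (chebSum s (fun n => starRingEnd ℂ (a n)))) := by
    rw [sq_gegenbauerNorm, ← intervalIntegral.integral_ofReal, gegenbauerForm]
    refine intervalIntegral.integral_congr fun θ _ => ?_
    simp only [← conj_eval_iterate_derivative_chebSum]
    push_cast
    rw [← Complex.mul_conj']
  apply Complex.ofReal_injective
  rw [hform, chebSum, iterate_derivative_sum_C_mul, gegenbauerForm_sum_left]
  push_cast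
  refine Finset.sum_congr rfl fun n hn => ?_
  rw [gegenbauerForm_comm, gegenbauerForm_iterate_derivative, chebSum, gegenbauerForm_sum_left]
  simp only [gegenbauerForm_zero_T_T, mul_ite, mul_zero, Finset.sum_ite_eq', hn, if_true]
  rw [← Complex.mul_conj']
  ring

lemma exists_eq_chebSum (p : ℂ[X]) : ∃ (N : ℕ) (a : ℕ → ℂ), p = chebSum (Finset.range N) a := by
  have hunit : ∀ n, IsUnit (Chebyshev.chebyshevTsequence ℂ n).leadingCoeff := fun n => by
    simp
  have hspan : p ∈ Submodule.span ℂ (range (Chebyshev.chebyshevTsequence ℂ)) := by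
    rw [(Chebyshev.chebyshevTsequence ℂ).span hunit]
    exact Submodule.mem_top
  obtain ⟨c, rfl⟩ := Finsupp.mem_span_range_iff_exists_finsupp.mp hspan
  refine ⟨c.support.sup id + 1, c, ?_⟩
  simp only [chebSum, Finsupp.sum, smul_eq_C_mul]
  refine Finset.sum_subset (fun n hn => ?_) fun n _ hn => by simp [Finsupp.notMem_support_iff.mp hn]
  exact Finset.mem_range.mpr (Nat.lt_succ_of_le (Finset.le_sup (f := id) hn))

lemma prod_sq_sub_sq_nonneg (m n : ℕ) :
    0 ≤ ∏ j ∈ Finset.range m, ((n : ℝ) ^ 2 - (j : ℝ) ^ 2) := by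
  rcases le_or_gt m n with h | h
  · refine Finset.prod_nonneg fun j hj => sub_nonneg.mpr ?_
    gcongr
    exact (Finset.mem_range.mp hj).le.trans h
  · rw [Finset.prod_eq_zero (Finset.mem_range.mpr h) (by ring)]

lemma prod_sq_sub_sq_le (m n : ℕ) :
    ∏ j ∈ Finset.range m, ((n : ℝ) ^ 2 - (j : ℝ) ^ 2) ≤ (n : ℝ) ^ (2 * m) := by
  rcases le_or_gt m n with h | h
  · calc ∏ j ∈ Finset.range m, ((n : ℝ) ^ 2 - (j : ℝ) ^ 2)
        ≤ ∏ _j ∈ Finset.range m, (n : ℝ) ^ 2 := by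
          refine Finset.prod_le_prod (fun j hj => sub_nonneg.mpr ?_) fun j _ =>
            sub_le_self _ (sq_nonneg _)
          gcongr
          exact (Finset.mem_range.mp hj).le.trans h
      _ = (n : ℝ) ^ (2 * m) := by rw [Finset.prod_const, Finset.card_range, pow_mul]
  · rw [Finset.prod_eq_zero (Finset.mem_range.mpr h) (by ring)]
    positivity

lemma pow_le_mul_prod_sq_sub_sq {m n : ℕ} (hmn : m ≤ n) :
    (n : ℝ) ^ (2 * m) ≤ (m : ℝ) ^ m * ∏ j ∈ Finset.range m, ((n : ℝ) ^ 2 - (j : ℝ) ^ 2) := by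
  have hm : (m : ℝ) ^ m = ∏ _j ∈ Finset.range m, (m : ℝ) := by simp
  have hn : (n : ℝ) ^ (2 * m) = ∏ _j ∈ Finset.range m, (n : ℝ) ^ 2 := by simp [pow_mul]
  rw [hm, hn, ← Finset.prod_mul_distrib]
  refine Finset.prod_le_prod (fun j _ => by positivity) fun j hj => ?_
  have hj' : (j : ℝ) + 1 ≤ m := by exact_mod_cast Finset.mem_range.mp hj
  have hmn' : (m : ℝ) ≤ n := by exact_mod_cast hmn
  have hlin : (j : ℝ) * m ≤ (m - 1) * n := by nlinarith [j.cast_nonneg (α := ℝ)]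
  have hsq : (j : ℝ) ^ 2 * m ≤ (m - 1) * n ^ 2 := by nlinarith [j.cast_nonneg (α := ℝ)]
  linarith

lemma sum_pow_mul_norm_sq_le {m : ℕ} {s t : Finset ℕ} (hts : t ⊆ s) (ht : ∀ n ∈ t, m ≤ n)
    (a : ℕ → ℂ) :
    ∑ n ∈ t, (n : ℝ) ^ (2 * m) * ‖a n‖ ^ 2 ≤
      (m : ℝ) ^ m * gegenbauerNorm m (derivative^[m] (chebSum s a)) ^ 2 := by
  have hnonneg : ∀ n : ℕ, 0 ≤ (m : ℝ) ^ m * (∏ j ∈ Finset.range m, ((n : ℝ) ^ 2 - (j : ℝ) ^ 2)) *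
      ‖a n‖ ^ 2 := fun n => by
    have := prod_sq_sub_sq_nonneg m n
    positivity
  rw [sq_gegenbauerNorm_iterate_derivative_chebSum, Finset.mul_sum]
  calc ∑ n ∈ t, (n : ℝ) ^ (2 * m) * ‖a n‖ ^ 2
      ≤ ∑ n ∈ t, (m : ℝ) ^ m * (∏ j ∈ Finset.range m, ((n : ℝ) ^ 2 - (j : ℝ) ^ 2)) *
          ‖a n‖ ^ 2 := by
        gcongr with n hn
        exact pow_le_mul_prod_sq_sub_sq (ht n hn)
    _ ≤ ∑ n ∈ s, (m : ℝ) ^ m * (∏ j ∈ Finset.range m, ((n : ℝ) ^ 2 - (j : ℝ) ^ 2)) *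
          ‖a n‖ ^ 2 := Finset.sum_le_sum_of_subset_of_nonneg hts fun n _ _ => hnonneg n
    _ ≤ _ := Finset.sum_le_sum fun n _ =>
        (le_mul_of_one_le_right (hnonneg n) (one_le_chebNormSq n)).trans_eq (by ring)

lemma sq_gegenbauerNorm_iterate_derivative_chebSum_le (m : ℕ) (s : Finset ℕ) (a : ℕ → ℂ) :
    gegenbauerNorm m (derivative^[m] (chebSum s a)) ^ 2 ≤
      Real.pi * ∑ n ∈ s, (n : ℝ) ^ (2 * m) * ‖a n‖ ^ 2 := by
  rw [sq_gegenbauerNorm_iterate_derivative_chebSum, Finset.mul_sum]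
  refine Finset.sum_le_sum fun n _ => ?_
  calc ‖a n‖ ^ 2 * ((∏ j ∈ Finset.range m, ((n : ℝ) ^ 2 - (j : ℝ) ^ 2)) * chebNormSq n)
      ≤ ‖a n‖ ^ 2 * ((n : ℝ) ^ (2 * m) * Real.pi) := by
        gcongr
        · exact zero_le_one.trans (one_le_chebNormSq n)
        · exact prod_sq_sub_sq_le m n
        · exact chebNormSq_le n
    _ = Real.pi * ((n : ℝ) ^ (2 * m) * ‖a n‖ ^ 2) := by ring

/-! ### Aliasing at the Chebyshev nodes -/

/-- The index `k ≤ L` to which `n` folds: `T_n` and `T_k` agree at the points `cos (ℓ π / L)`. -/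
def aliasIndex (L n : ℕ) : ℕ := if Even (n / L) then n % L else L - n % L

/-- The interpolation error, at the points `cos (ℓ π / L)`, of the Chebyshev series with
coefficients `a` over `s`: interpolation replaces each `T_n` by its alias. -/
def aliasError (L : ℕ) (s : Finset ℕ) (a : ℕ → ℂ) : ℂ[X] :=
  ∑ n ∈ s, C (a n) * (Chebyshev.T ℂ (aliasIndex L n) - Chebyshev.T ℂ n)

/-- The Chebyshev coefficients of `aliasError L s a` when all indices in `s` exceed `L`. -/
def errorCoeff (L : ℕ) (s : Finset ℕ) (a : ℕ → ℂ) (k : ℕ) : ℂ :=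
  if k ≤ L then ∑ n ∈ s with aliasIndex L n = k, a n else -a k

lemma aliasIndex_le {L : ℕ} (hL : 0 < L) (n : ℕ) : aliasIndex L n ≤ L := by
  unfold aliasIndex
  have := Nat.mod_lt n hL
  split_ifs <;> omega

lemma aliasIndex_of_le {L n : ℕ} (hL : 0 < L) (h : n ≤ L) : aliasIndex L n = n := by
  unfold aliasIndex
  rcases h.lt_or_eq with h | rfl
  · simp [Nat.div_eq_of_lt h, Nat.mod_eq_of_lt h]
  · simp [Nat.div_self hL]

lemma eq_of_aliasIndex_eq_of_div_eq {L n n' : ℕ} (hL : 0 < L)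
    (halias : aliasIndex L n = aliasIndex L n') (hdiv : n / L = n' / L) : n = n' := by
  unfold aliasIndex at halias
  rw [hdiv] at halias
  have hn := Nat.div_add_mod n L
  have hn' := Nat.div_add_mod n' L
  have := Nat.mod_lt n hL
  have := Nat.mod_lt n' hL
  rw [hdiv] at hn
  split_ifs at halias <;> omega

lemma cos_mul_aliasIndex {L : ℕ} (hL : 0 < L) (n ℓ : ℕ) :
    Real.cos (aliasIndex L n * (ℓ * Real.pi / L)) = Real.cos (n * (ℓ * Real.pi / L)) := by
  have hL' : (L : ℝ) ≠ 0 := by exact_mod_cast hL.ne'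
  have hn : (n : ℝ) = L * (n / L : ℕ) + (n % L : ℕ) := by exact_mod_cast (Nat.div_add_mod n L).symm
  unfold aliasIndex
  split_ifs with h
  · obtain ⟨j, hj⟩ := h
    have hshift : (n : ℝ) * (ℓ * Real.pi / L) =
        ((n % L : ℕ) : ℝ) * (ℓ * Real.pi / L) + ((j * ℓ : ℕ) : ℝ) * (2 * Real.pi) := by
      rw [hn, hj]
      field_simp
      push_cast
      ring
    rw [hshift, Real.cos_add_nat_mul_two_pi]
  · obtain ⟨j, hj⟩ := Nat.not_even_iff_odd.mp h
    have hreflect : (n : ℝ) * (ℓ * Real.pi / L) =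
        (((j + 1) * ℓ : ℕ) : ℝ) * (2 * Real.pi) -
          ((L - n % L : ℕ) : ℝ) * (ℓ * Real.pi / L) := by
      rw [Nat.cast_sub (Nat.mod_lt n hL).le, hn, hj]
      field_simp
      push_cast
      ring
    rw [hreflect, Real.cos_nat_mul_two_pi_sub]

lemma eval_T_aliasIndex {L : ℕ} (hL : 0 < L) (n ℓ : ℕ) :
    (Chebyshev.T ℂ (aliasIndex L n)).eval (Real.cos (ℓ * Real.pi / L) : ℂ) =
      (Chebyshev.T ℂ n).eval (Real.cos (ℓ * Real.pi / L) : ℂ) := by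
  rw [← Chebyshev.complex_ofReal_eval_T, ← Chebyshev.complex_ofReal_eval_T, Chebyshev.T_real_cos,
    Chebyshev.T_real_cos]
  exact_mod_cast congrArg Complex.ofReal (cos_mul_aliasIndex hL n ℓ)

lemma eval_aliasError_cos {L : ℕ} (hL : 0 < L) (s : Finset ℕ) (a : ℕ → ℂ) (ℓ : ℕ) :
    (aliasError L s a).eval (Real.cos (ℓ * Real.pi / L) : ℂ) = 0 := by
  simp only [aliasError, eval_finsetSum, eval_mul, eval_sub, eval_T_aliasIndex hL, sub_self,
    mul_zero, Finset.sum_const_zero]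

lemma eval_one_aliasError (L : ℕ) (s : Finset ℕ) (a : ℕ → ℂ) : (aliasError L s a).eval 1 = 0 := by
  simp [aliasError, eval_finsetSum]

lemma eval_neg_one_T_aliasIndex {L : ℕ} (hL : 0 < L) (n : ℕ) :
    (Chebyshev.T ℂ (aliasIndex L n)).eval (-1) = (Chebyshev.T ℂ n).eval (-1) := by
  have h := eval_T_aliasIndex hL n L
  rw [mul_div_cancel_left₀ _ (Nat.cast_ne_zero.mpr hL.ne'), Real.cos_pi] at h
  simpa only [Complex.ofReal_neg, Complex.ofReal_one] using h

lemma eval_neg_one_aliasError {L : ℕ} (hL : 0 < L) (s : Finset ℕ) (a : ℕ → ℂ) :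
    (aliasError L s a).eval (-1) = 0 := by
  simp only [aliasError, eval_finsetSum, eval_mul, eval_sub, eval_neg_one_T_aliasIndex hL,
    sub_self, mul_zero, Finset.sum_const_zero]

lemma injOn_node (L : ℕ) : InjOn (fun ℓ => (node L ℓ : ℂ)) (Finset.range (L + 1) : Set ℕ) := by
  intro i hi j hj h
  have hcos : Chebyshev.node L i = Chebyshev.node L j :=
    add_left_cancel (Complex.ofReal_injective h)
  exact (Chebyshev.strictAntiOn_node L).injOn (by simpa using hi) (by simpa using hj) hcos

lemma natDegree_chebSum_add_aliasError_le {L : ℕ} (hL : 0 < L) (s : Finset ℕ) (a : ℕ → ℂ) :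
    (chebSum s a + aliasError L s a).natDegree ≤ L := by
  have hsum : chebSum s a + aliasError L s a =
      ∑ n ∈ s, C (a n) * Chebyshev.T ℂ (aliasIndex L n) := by
    rw [chebSum, aliasError, ← Finset.sum_add_distrib]
    exact Finset.sum_congr rfl fun n _ => by ring
  rw [hsum]
  refine natDegree_sum_le_of_forall_le s _ fun n _ => (natDegree_C_mul_le _ _).trans ?_
  simpa [Chebyshev.natDegree_T] using aliasIndex_le hL n

theorem interp_chebSum {L : ℕ} (hL : 0 < L) (s : Finset ℕ) (a : ℕ → ℂ) :
    interp L (fun x : ℝ => ((chebSum s a).comp (X - C 1)).eval (x : ℂ)) =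
      (chebSum s a + aliasError L s a).comp (X - C 1) := by
  refine (Lagrange.eq_interpolate_of_eval_eq _ (injOn_node L) ?_ fun ℓ _ => ?_).symm
  · rw [Finset.card_range]
    have hdeg : ((chebSum s a + aliasError L s a).comp (X - C 1)).natDegree ≤ L := by
      rw [natDegree_comp, natDegree_X_sub_C, mul_one]
      exact natDegree_chebSum_add_aliasError_le hL s a
    exact (degree_le_of_natDegree_le hdeg).trans_lt (by exact_mod_cast Nat.lt_succ_self L)
  · have hcos : ((node L ℓ : ℝ) : ℂ) - 1 = (Real.cos (ℓ * Real.pi / L) : ℂ) := by simp [node]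
    simp only [eval_comp, eval_sub, eval_X, eval_C, hcos, eval_add, eval_aliasError_cos hL,
      add_zero]

lemma aliasError_filter_lt {L : ℕ} (hL : 0 < L) (s : Finset ℕ) (a : ℕ → ℂ) :
    aliasError L (s.filter (L < ·)) a = aliasError L s a := by
  rw [aliasError, Finset.sum_filter]
  refine Finset.sum_congr rfl fun n _ => ?_
  split_ifs with h
  · rfl
  · rw [aliasIndex_of_le hL (not_lt.mp h), sub_self, mul_zero]

lemma sum_inv_pow_filter_aliasIndex_le {L m : ℕ} (hL : 0 < L) (hm : 1 ≤ m) {s : Finset ℕ}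
    (hs : ∀ n ∈ s, L < n) (k : ℕ) :
    ∑ n ∈ s with aliasIndex L n = k, ((n : ℝ) ^ (2 * m))⁻¹ ≤ 2 * ((L : ℝ) ^ (2 * m))⁻¹ := by
  set t := s.filter (fun n => aliasIndex L n = k)
  have hinj : Set.InjOn (fun n => n / L) (t : Set ℕ) := fun i hi j hj hij =>
    eq_of_aliasIndex_eq_of_div_eq hL
      ((Finset.mem_filter.mp hi).2.trans (Finset.mem_filter.mp hj).2.symm) hij
  have hpos : ∀ n ∈ t, 1 ≤ n / L := fun n hn =>
    (Nat.one_le_div_iff hL).mpr (hs n (Finset.mem_filter.mp hn).1).le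
  have hterm : ∀ n ∈ t,
      ((n : ℝ) ^ (2 * m))⁻¹ ≤ (((n / L : ℕ) : ℝ) ^ 2)⁻¹ * ((L : ℝ) ^ (2 * m))⁻¹ := fun n hn => by
    have hquot : (1 : ℝ) ≤ ((n / L : ℕ) : ℝ) := by exact_mod_cast hpos n hn
    have hmul : ((n / L : ℕ) : ℝ) * L ≤ n := by exact_mod_cast Nat.div_mul_le_self n L
    rw [← mul_inv]
    refine inv_anti₀ (by positivity) ?_
    calc ((n / L : ℕ) : ℝ) ^ 2 * (L : ℝ) ^ (2 * m)
        ≤ ((n / L : ℕ) : ℝ) ^ (2 * m) * (L : ℝ) ^ (2 * m) := by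
          gcongr
          omega
      _ = (((n / L : ℕ) : ℝ) * L) ^ (2 * m) := by rw [mul_pow]
      _ ≤ (n : ℝ) ^ (2 * m) := by gcongr
  have hzeta : ∑ q ∈ t.image (fun n => n / L), ((q : ℝ) ^ 2)⁻¹ ≤ 2 := by
    set u := t.image (fun n => n / L)
    have hsub : u ⊆ Finset.Ioo 0 (u.sup id + 1) := fun q hq => by
      obtain ⟨n, hn, rfl⟩ := Finset.mem_image.mp hq
      exact Finset.mem_Ioo.mpr ⟨hpos n hn, Nat.lt_succ_of_le (Finset.le_sup (f := id) hq)⟩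
    refine (Finset.sum_le_sum_of_subset_of_nonneg hsub fun _ _ _ => by positivity).trans ?_
    simpa using sum_Ioo_inv_sq_le (α := ℝ) 0 (u.sup id + 1)
  calc ∑ n ∈ t, ((n : ℝ) ^ (2 * m))⁻¹
      ≤ ∑ n ∈ t, (((n / L : ℕ) : ℝ) ^ 2)⁻¹ * ((L : ℝ) ^ (2 * m))⁻¹ := Finset.sum_le_sum hterm
    _ = (∑ q ∈ t.image (fun n => n / L), ((q : ℝ) ^ 2)⁻¹) * ((L : ℝ) ^ (2 * m))⁻¹ := by
        rw [Finset.sum_image hinj, Finset.sum_mul]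
    _ ≤ 2 * ((L : ℝ) ^ (2 * m))⁻¹ := by gcongr

lemma norm_sum_filter_aliasIndex_sq_le {L m : ℕ} (hL : 0 < L) (hm : 1 ≤ m) {s : Finset ℕ}
    (hs : ∀ n ∈ s, L < n) (a : ℕ → ℂ) (k : ℕ) :
    ‖∑ n ∈ s with aliasIndex L n = k, a n‖ ^ 2 ≤
      2 * ((L : ℝ) ^ (2 * m))⁻¹ *
        ∑ n ∈ s with aliasIndex L n = k, (n : ℝ) ^ (2 * m) * ‖a n‖ ^ 2 := by
  set t := s.filter (fun n => aliasIndex L n = k)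
  have htriangle : ‖∑ n ∈ t, a n‖ ≤ ∑ n ∈ t, ((n : ℝ) ^ m)⁻¹ * ((n : ℝ) ^ m * ‖a n‖) := by
    refine (norm_sum_le _ _).trans (Finset.sum_le_sum fun n hn => ?_)
    have hn : (0 : ℝ) < n := by
      exact_mod_cast (Nat.zero_le L).trans_lt (hs n (Finset.mem_filter.mp hn).1)
    rw [inv_mul_cancel_left₀ (by positivity)]
  calc ‖∑ n ∈ t, a n‖ ^ 2 ≤ (∑ n ∈ t, ((n : ℝ) ^ m)⁻¹ * ((n : ℝ) ^ m * ‖a n‖)) ^ 2 := by gcongr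
    _ ≤ (∑ n ∈ t, (((n : ℝ) ^ m)⁻¹) ^ 2) * ∑ n ∈ t, ((n : ℝ) ^ m * ‖a n‖) ^ 2 :=
        Finset.sum_mul_sq_le_sq_mul_sq _ _ _
    _ = (∑ n ∈ t, ((n : ℝ) ^ (2 * m))⁻¹) * ∑ n ∈ t, (n : ℝ) ^ (2 * m) * ‖a n‖ ^ 2 := by
        simp only [inv_pow, mul_pow, ← pow_mul, mul_comm m]
    _ ≤ _ := by
        gcongr
        exact sum_inv_pow_filter_aliasIndex_le hL hm hs k

lemma disjoint_range_of_lt {L : ℕ} {s : Finset ℕ} (hs : ∀ n ∈ s, L < n) :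
    Disjoint (Finset.range (L + 1)) s :=
  Finset.disjoint_left.mpr fun n hn hn' =>
    (hs n hn').not_ge (Nat.lt_succ_iff.mp (Finset.mem_range.mp hn))

lemma aliasIndex_mem_range {L : ℕ} (hL : 0 < L) (n : ℕ) : aliasIndex L n ∈ Finset.range (L + 1) :=
  Finset.mem_range.mpr (Nat.lt_succ_of_le (aliasIndex_le hL n))

lemma aliasError_eq_chebSum {L : ℕ} (hL : 0 < L) {s : Finset ℕ} (hs : ∀ n ∈ s, L < n)
    (a : ℕ → ℂ) :
    aliasError L s a = chebSum (Finset.range (L + 1) ∪ s) (errorCoeff L s a) := by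
  simp only [aliasError, chebSum, mul_sub, Finset.sum_sub_distrib]
  rw [Finset.sum_union (disjoint_range_of_lt hs), sub_eq_add_neg, ← Finset.sum_neg_distrib]
  congr 1
  · rw [← Finset.sum_fiberwise_of_maps_to (g := aliasIndex L)
      (fun n _ => aliasIndex_mem_range hL n)]
    refine Finset.sum_congr rfl fun k hk => ?_
    rw [errorCoeff, if_pos (Nat.lt_succ_iff.mp (Finset.mem_range.mp hk)), map_sum, Finset.sum_mul]
    exact Finset.sum_congr rfl fun n hn => by rw [(Finset.mem_filter.mp hn).2]
  · exact Finset.sum_congr rfl fun n hn => by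
      rw [errorCoeff, if_neg (not_le.mpr (hs n hn)), map_neg, neg_mul]

lemma sum_range_pow_mul_norm_errorCoeff_sq_le {L m : ℕ} (hL : 0 < L) (hm : 1 ≤ m) (j : ℕ)
    {s : Finset ℕ} (hs : ∀ n ∈ s, L < n) (a : ℕ → ℂ) :
    ∑ k ∈ Finset.range (L + 1), (k : ℝ) ^ (2 * j) * ‖errorCoeff L s a k‖ ^ 2 ≤
      2 * ((L : ℝ) ^ (2 * j) * ((L : ℝ) ^ (2 * m))⁻¹) *
        ∑ n ∈ s, (n : ℝ) ^ (2 * m) * ‖a n‖ ^ 2 := by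
  rw [← Finset.sum_fiberwise_of_maps_to (s := s) (g := aliasIndex L)
    (fun n _ => aliasIndex_mem_range hL n), Finset.mul_sum]
  refine Finset.sum_le_sum fun k hk => ?_
  have hkL := Nat.lt_succ_iff.mp (Finset.mem_range.mp hk)
  rw [errorCoeff, if_pos hkL]
  calc (k : ℝ) ^ (2 * j) * ‖∑ n ∈ s with aliasIndex L n = k, a n‖ ^ 2
      ≤ (L : ℝ) ^ (2 * j) * (2 * ((L : ℝ) ^ (2 * m))⁻¹ *
        ∑ n ∈ s with aliasIndex L n = k, (n : ℝ) ^ (2 * m) * ‖a n‖ ^ 2) := by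
        gcongr
        exact norm_sum_filter_aliasIndex_sq_le hL hm hs a k
    _ = _ := by ring

lemma sum_pow_mul_norm_errorCoeff_sq_le_of_lt {L m j : ℕ} (hL : 0 < L) (hj : j ≤ m)
    {s : Finset ℕ} (hs : ∀ n ∈ s, L < n) (a : ℕ → ℂ) :
    ∑ n ∈ s, (n : ℝ) ^ (2 * j) * ‖errorCoeff L s a n‖ ^ 2 ≤
      ((L : ℝ) ^ (2 * j) * ((L : ℝ) ^ (2 * m))⁻¹) *
        ∑ n ∈ s, (n : ℝ) ^ (2 * m) * ‖a n‖ ^ 2 := by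
  obtain ⟨i, rfl⟩ := Nat.exists_eq_add_of_le hj
  rw [Finset.mul_sum]
  refine Finset.sum_le_sum fun n hn => ?_
  have hLn : (L : ℝ) ≤ n := by exact_mod_cast (hs n hn).le
  have hgain : (1 : ℝ) ≤ ((L : ℝ) ^ (2 * i))⁻¹ * (n : ℝ) ^ (2 * i) := by
    rw [inv_mul_eq_div, one_le_div (by positivity)]
    gcongr
  rw [errorCoeff, if_neg (not_le.mpr (hs n hn)), norm_neg]
  calc (n : ℝ) ^ (2 * j) * ‖a n‖ ^ 2
      ≤ (n : ℝ) ^ (2 * j) * ‖a n‖ ^ 2 * (((L : ℝ) ^ (2 * i))⁻¹ * (n : ℝ) ^ (2 * i)) :=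
        le_mul_of_one_le_right (by positivity) hgain
    _ = _ := by
        rw [mul_add 2 j i, pow_add, pow_add]
        field_simp

theorem gegenbauerNorm_iterate_derivative_aliasError_le {L m j : ℕ} (hL : 0 < L) (hm : 1 ≤ m)
    (hmL : m ≤ L + 1) (hj : j ≤ m) (s : Finset ℕ) (a : ℕ → ℂ) :
    gegenbauerNorm j (derivative^[j] (aliasError L s a)) ≤
      √(3 * Real.pi * (m : ℝ) ^ m) * ((L : ℝ) ^ j / (L : ℝ) ^ m) *
        gegenbauerNorm m (derivative^[m] (chebSum s a)) := by
  set t := s.filter (L < ·)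
  have hLt : ∀ n ∈ t, L < n := fun n hn => (Finset.mem_filter.mp hn).2
  refine le_of_sq_le_sq ?_ (mul_nonneg (by positivity) (Real.sqrt_nonneg _))
  rw [← aliasError_filter_lt hL, aliasError_eq_chebSum hL hLt, mul_pow, mul_pow,
    Real.sq_sqrt (by positivity), div_pow, ← pow_mul, ← pow_mul, mul_comm j, mul_comm m 2]
  calc gegenbauerNorm j
        (derivative^[j] (chebSum (Finset.range (L + 1) ∪ t) (errorCoeff L t a))) ^ 2
      ≤ Real.pi * ∑ n ∈ Finset.range (L + 1) ∪ t,
          (n : ℝ) ^ (2 * j) * ‖errorCoeff L t a n‖ ^ 2 :=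
        sq_gegenbauerNorm_iterate_derivative_chebSum_le j _ _
    _ ≤ Real.pi * (3 * ((L : ℝ) ^ (2 * j) * ((L : ℝ) ^ (2 * m))⁻¹) *
          ∑ n ∈ t, (n : ℝ) ^ (2 * m) * ‖a n‖ ^ 2) := by
        rw [Finset.sum_union (disjoint_range_of_lt hLt)]
        gcongr
        linarith [sum_range_pow_mul_norm_errorCoeff_sq_le hL hm j hLt a,
          sum_pow_mul_norm_errorCoeff_sq_le_of_lt hL hj hLt a]
    _ ≤ Real.pi * (3 * ((L : ℝ) ^ (2 * j) * ((L : ℝ) ^ (2 * m))⁻¹) *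
          ((m : ℝ) ^ m * gegenbauerNorm m (derivative^[m] (chebSum s a)) ^ 2)) := by
        gcongr
        exact sum_pow_mul_norm_sq_le (Finset.filter_subset _ s) (fun n hn => by
          have := hLt n hn; omega) a
    _ = _ := by ring

/-! ### Exponential integrals in the variable `s = 1 + cos θ` -/

/-- The integral of `q(s - 1) exp(s z)` over `[0, 2]`, in the variable `s = 1 + cos θ`. -/
def cosInt (z : ℂ) (q : ℂ[X]) : ℂ :=
  ∫ θ in (0 : ℝ)..Real.pi,
    q.eval (Real.cos θ : ℂ) * Complex.exp ((1 + Real.cos θ : ℝ) * z) * (Real.sin θ : ℂ)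

/-- A constant such that `exp (σ u) ≤ expConst μ * exp (-(1 + |σ|) u)` whenever `σ ≤ μ` and
`0 ≤ u ≤ 2`. -/
def expConst (μ : ℝ) : ℝ := Real.exp (2 + 4 * |μ|)

lemma one_le_expConst (μ : ℝ) : 1 ≤ expConst μ := Real.one_le_exp (by positivity)

lemma expConst_pos (μ : ℝ) : 0 < expConst μ := Real.exp_pos _

lemma exp_mul_le_expConst_mul {μ σ u : ℝ} (hσ : σ ≤ μ) (h0 : 0 ≤ u) (h2 : u ≤ 2) :
    Real.exp (σ * u) ≤ expConst μ * Real.exp (-(1 + |σ|) * u) := by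
  rw [expConst, ← Real.exp_add]
  refine Real.exp_le_exp.mpr ?_
  have hσμ : σ + |σ| ≤ 2 * |μ| := by
    rcases abs_cases σ with h | h <;> linarith [le_abs_self μ, abs_nonneg μ]
  nlinarith [mul_le_mul_of_nonneg_right hσμ h0, mul_le_mul_of_nonneg_left h2 (abs_nonneg μ)]

lemma integral_sin_smul_comp_one_add_cos {E : Type*} [NormedAddCommGroup E] [NormedSpace ℝ E]
    {g : ℝ → E} (hg : Continuous g) :
    ∫ θ in (0 : ℝ)..Real.pi, Real.sin θ • g (1 + Real.cos θ) = ∫ s in (0 : ℝ)..2, g s := by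
  have h := intervalIntegral.integral_deriv_smul_comp (a := 0) (b := Real.pi)
    (f := fun θ => 1 + Real.cos θ) (f' := fun θ => -Real.sin θ) (g := g)
    (fun θ _ => by simpa using (Real.hasDerivAt_cos θ).const_add 1) (by fun_prop) hg
  have hends : (1 : ℝ) + 1 = 2 ∧ (1 : ℝ) + -1 = 0 := by norm_num
  simpa only [Function.comp_apply, neg_smul, intervalIntegral.integral_neg, Real.cos_zero,
    Real.cos_pi, hends, intervalIntegral.integral_symm 0 2, neg_inj] using h

lemma integral_comp_sub_one_mul_exp (z : ℂ) (q : ℂ[X]) :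
    ∫ s in (0 : ℝ)..2, (q.comp (X - C 1)).eval (s : ℂ) * Complex.exp (s * z) = cosInt z q := by
  rw [← integral_sin_smul_comp_one_add_cos (by fun_prop), cosInt]
  refine intervalIntegral.integral_congr fun θ _ => ?_
  simp only [eval_comp, eval_sub, eval_X, eval_C, Complex.real_smul, Complex.ofReal_add,
    Complex.ofReal_one, add_sub_cancel_left]
  ring

lemma cosInt_add (z : ℂ) (p q : ℂ[X]) : cosInt z (p + q) = cosInt z p + cosInt z q := by
  unfold cosInt
  rw [← intervalIntegral.integral_add (Continuous.intervalIntegrable (by fun_prop) _ _)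
    (Continuous.intervalIntegrable (by fun_prop) _ _)]
  exact intervalIntegral.integral_congr fun θ _ => by simp only [eval_add]; ring

lemma cosInt_sum {ι : Type*} (z : ℂ) (s : Finset ι) (a : ι → ℂ) (p : ι → ℂ[X]) :
    cosInt z (∑ i ∈ s, C (a i) * p i) = ∑ i ∈ s, a i * cosInt z (p i) := by
  simp only [cosInt, ← intervalIntegral.integral_const_mul]
  rw [← intervalIntegral.integral_finsetSum
    fun i _ => Continuous.intervalIntegrable (by fun_prop) _ _]
  refine intervalIntegral.integral_congr fun θ _ => ?_
  simp only [eval_finsetSum, eval_mul, eval_C, Finset.sum_mul]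
  exact Finset.sum_congr rfl fun i _ => by ring

lemma mul_cosInt (z : ℂ) (q : ℂ[X]) :
    z * cosInt z q = q.eval 1 * Complex.exp (2 * z) - q.eval (-1) - cosInt z (derivative q) := by
  set F : ℝ → ℂ := fun θ => q.eval (Real.cos θ : ℂ) * Complex.exp ((1 + Real.cos θ : ℝ) * z)
    with hF
  have hderiv : ∀ θ : ℝ, HasDerivAt F
      (-(z * (q.eval (Real.cos θ : ℂ) * Complex.exp ((1 + Real.cos θ : ℝ) * z) *
        (Real.sin θ : ℂ))) -
      (derivative q).eval (Real.cos θ : ℂ) * Complex.exp ((1 + Real.cos θ : ℝ) * z) *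
        (Real.sin θ : ℂ)) θ := fun θ => by
    have hexp : HasDerivAt (fun θ : ℝ => Complex.exp ((1 + Real.cos θ : ℝ) * z)) _ θ :=
      (((Real.hasDerivAt_cos θ).const_add 1).ofReal_comp.mul_const z).cexp
    refine ((hasDerivAt_eval_cos q θ).mul hexp).congr_deriv ?_
    push_cast
    ring
  have hparts := intervalIntegral.integral_eq_sub_of_hasDerivAt (a := 0) (b := Real.pi)
    (fun θ _ => hderiv θ) (Continuous.intervalIntegrable (by fun_prop) _ _)
  rw [intervalIntegral.integral_sub (Continuous.intervalIntegrable (by fun_prop) _ _)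
    (Continuous.intervalIntegrable (by fun_prop) _ _), intervalIntegral.integral_neg,
    intervalIntegral.integral_const_mul] at hparts
  have hends : F Real.pi - F 0 = q.eval (-1) - q.eval 1 * Complex.exp (2 * z) := by
    have htwo : ((1 + 1 : ℝ) : ℂ) = 2 := by norm_num
    simp only [hF, Real.cos_pi, Real.cos_zero, htwo, add_neg_cancel, Complex.ofReal_zero,
      Complex.ofReal_neg, Complex.ofReal_one, zero_mul, Complex.exp_zero, mul_one]
  rw [hends] at hparts
  unfold cosInt
  linear_combination -hparts

lemma two_div_pi_sq_mul_le_one_add_cos {θ : ℝ} (h0 : 0 ≤ θ) (h1 : θ ≤ Real.pi) :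
    2 / Real.pi ^ 2 * (Real.pi - θ) ^ 2 ≤ 1 + Real.cos θ := by
  have h := Real.cos_le_one_sub_mul_cos_sq (x := Real.pi - θ)
    (by rw [abs_of_nonneg (by linarith)]; linarith)
  rw [Real.cos_pi_sub] at h
  linarith

lemma integral_exp_neg_mul_sq_le {b : ℝ} (hb : 0 < b) (c : ℝ) (hc : 0 ≤ c) :
    ∫ θ in (0 : ℝ)..c, Real.exp (-b * θ ^ 2) ≤ √(Real.pi / b) := by
  rw [← integral_gaussian, intervalIntegral.integral_of_le hc]
  exact setIntegral_le_integral (integrable_exp_neg_mul_sq hb)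
    (Filter.Eventually.of_forall fun x => (Real.exp_pos _).le)

lemma integral_exp_neg_mul_one_add_cos_le {κ : ℝ} (hκ : 0 < κ) :
    ∫ θ in (0 : ℝ)..Real.pi, Real.exp (-κ * (1 + Real.cos θ)) ≤ 4 * κ ^ (-(1 / 2) : ℝ) := by
  have hπ := Real.pi_pos
  set b := 2 * κ / Real.pi ^ 2 with hb
  have hconst : Real.pi / b ≤ 4 ^ 2 * κ⁻¹ := by
    have hcube : Real.pi ^ 3 ≤ 32 :=
      (pow_le_pow_left₀ hπ.le Real.pi_lt_d2.le 3).trans (by norm_num)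
    rw [hb, div_div_eq_mul_div, ← div_eq_mul_inv, div_le_div_iff₀ (by positivity) hκ]
    nlinarith
  calc ∫ θ in (0 : ℝ)..Real.pi, Real.exp (-κ * (1 + Real.cos θ))
      ≤ ∫ θ in (0 : ℝ)..Real.pi, Real.exp (-b * (Real.pi - θ) ^ 2) := by
        refine intervalIntegral.integral_mono_on hπ.le
          (Continuous.intervalIntegrable (by fun_prop) _ _)
          (Continuous.intervalIntegrable (by fun_prop) _ _) fun θ hθ => Real.exp_le_exp.mpr ?_
        have hquad := mul_le_mul_of_nonneg_left (two_div_pi_sq_mul_le_one_add_cos hθ.1 hθ.2) hκ.le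
        have hb' : b * (Real.pi - θ) ^ 2 = κ * (2 / Real.pi ^ 2 * (Real.pi - θ) ^ 2) := by
          rw [hb]; ring
        linarith
    _ = ∫ θ in (0 : ℝ)..Real.pi, Real.exp (-b * θ ^ 2) := by
        rw [intervalIntegral.integral_comp_sub_left (fun θ => Real.exp (-b * θ ^ 2)), sub_self,
          sub_zero]
    _ ≤ √(Real.pi / b) := integral_exp_neg_mul_sq_le (by positivity) _ hπ.le
    _ ≤ √(4 ^ 2 * κ⁻¹) := Real.sqrt_le_sqrt hconst
    _ = 4 * κ ^ (-(1 / 2) : ℝ) := by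
        rw [Real.sqrt_mul (by positivity), Real.sqrt_sq (by norm_num), Real.sqrt_inv,
          Real.rpow_neg hκ.le, Real.sqrt_eq_rpow]

lemma integral_exp_neg_mul_one_add_cos_sq_le {κ : ℝ} (hκ : 0 < κ) :
    ∫ θ in (0 : ℝ)..Real.pi, Real.exp (-κ * (1 + Real.cos θ)) ^ 2 ≤ 4 * κ ^ (-(1 / 2) : ℝ) := by
  refine le_trans ?_ (integral_exp_neg_mul_one_add_cos_le hκ)
  refine intervalIntegral.integral_mono_on Real.pi_pos.le
    (Continuous.intervalIntegrable (by fun_prop) _ _)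
    (Continuous.intervalIntegrable (by fun_prop) _ _) fun θ _ => ?_
  refine pow_le_of_le_one (Real.exp_pos _).le (Real.exp_le_one_iff.mpr ?_) two_ne_zero
  nlinarith [Real.neg_one_le_cos θ]

lemma integral_exp_neg_mul_one_add_cos_mul_sin_sq_le {κ : ℝ} (hκ : 0 < κ) :
    ∫ θ in (0 : ℝ)..Real.pi, (Real.exp (-κ * (1 + Real.cos θ)) * Real.sin θ) ^ 2 ≤
      8 * κ ^ (-(3 / 2) : ℝ) := by
  have hpoint : ∀ θ : ℝ, (Real.exp (-κ * (1 + Real.cos θ)) * Real.sin θ) ^ 2 ≤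
      2 / κ * Real.exp (-κ * (1 + Real.cos θ)) := fun θ => by
    set u := 1 + Real.cos θ
    have hsin : Real.sin θ ^ 2 ≤ 2 * u := by
      rw [Real.sin_sq]
      nlinarith [Real.neg_one_le_cos θ, Real.cos_le_one θ]
    have hmul_exp : κ * u * Real.exp (-κ * u) ≤ 1 := by
      rw [neg_mul, Real.exp_neg, ← div_eq_mul_inv]
      exact div_le_one_of_le₀ (by linarith [Real.add_one_le_exp (κ * u)]) (Real.exp_pos _).le
    calc (Real.exp (-κ * u) * Real.sin θ) ^ 2
        ≤ Real.exp (-κ * u) ^ 2 * (2 * u) := by rw [mul_pow]; gcongr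
      _ = 2 / κ * (κ * u * Real.exp (-κ * u)) * Real.exp (-κ * u) := by field_simp
      _ ≤ 2 / κ * 1 * Real.exp (-κ * u) := by gcongr
      _ = 2 / κ * Real.exp (-κ * u) := by rw [mul_one]
  calc ∫ θ in (0 : ℝ)..Real.pi, (Real.exp (-κ * (1 + Real.cos θ)) * Real.sin θ) ^ 2
      ≤ ∫ θ in (0 : ℝ)..Real.pi, 2 / κ * Real.exp (-κ * (1 + Real.cos θ)) :=
        intervalIntegral.integral_mono_on Real.pi_pos.le
          (Continuous.intervalIntegrable (by fun_prop) _ _)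
          (Continuous.intervalIntegrable (by fun_prop) _ _) fun θ _ => hpoint θ
    _ ≤ 2 / κ * (4 * κ ^ (-(1 / 2) : ℝ)) := by
        rw [intervalIntegral.integral_const_mul]
        gcongr
        exact integral_exp_neg_mul_one_add_cos_le hκ
    _ = 8 * κ ^ (-(3 / 2) : ℝ) := by
        rw [show (-(3 / 2) : ℝ) = -1 + -(1 / 2) by norm_num, Real.rpow_add hκ, Real.rpow_neg_one]
        ring

lemma integral_mul_le_sqrt_mul_sqrt {α : Type*} [MeasurableSpace α] {μ : Measure α} {f g : α → ℝ}
    (hf : MemLp f 2 μ) (hg : MemLp g 2 μ) :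
    ∫ x, f x * g x ∂μ ≤ √(∫ x, f x ^ 2 ∂μ) * √(∫ x, g x ^ 2 ∂μ) := by
  have hholder := integral_mul_norm_le_Lp_mul_Lq (μ := μ) (f := f) (g := g)
    Real.HolderConjugate.two_two (by rwa [ENNReal.ofReal_ofNat]) (by rwa [ENNReal.ofReal_ofNat])
  simp only [Real.rpow_two, Real.norm_eq_abs, sq_abs, ← Real.sqrt_eq_rpow] at hholder
  refine le_trans (integral_mono (hf.integrable_mul hg) ?_ fun x => ?_) hholder
  · exact hf.norm.integrable_mul hg.norm
  · exact (le_abs_self _).trans_eq (abs_mul _ _)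

lemma intervalIntegral_mul_le_sqrt_mul_sqrt {f g : ℝ → ℝ} (hf : Continuous f) (hg : Continuous g)
    {a b : ℝ} (hab : a ≤ b) :
    ∫ x in a..b, f x * g x ≤ √(∫ x in a..b, f x ^ 2) * √(∫ x in a..b, g x ^ 2) := by
  simp only [intervalIntegral.integral_of_le hab]
  have hLp : ∀ {h : ℝ → ℝ}, Continuous h → MemLp h 2 (volume.restrict (Ioc a b)) := fun hh =>
    (memLp_two_iff_integrable_sq hh.aestronglyMeasurable).mpr
      (hh.pow 2).integrableOn_Ioc
  exact integral_mul_le_sqrt_mul_sqrt (hLp hf) (hLp hg)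

lemma norm_cosInt_le {μ : ℝ} {z : ℂ} (hz : z.re ≤ μ) (q : ℂ[X]) :
    ‖cosInt z q‖ ≤ expConst μ * ∫ θ in (0 : ℝ)..Real.pi,
      ‖q.eval (Real.cos θ : ℂ)‖ *
        (Real.exp (-(1 + |z.re|) * (1 + Real.cos θ)) * Real.sin θ) := by
  rw [← intervalIntegral.integral_const_mul]
  refine intervalIntegral.norm_integral_le_of_norm_le Real.pi_pos.le
    (Filter.Eventually.of_forall fun θ hθ => ?_)
    (Continuous.intervalIntegrable (by fun_prop) _ _)
  have hsin : 0 ≤ Real.sin θ := Real.sin_nonneg_of_nonneg_of_le_pi hθ.1.le hθ.2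
  rw [norm_mul, norm_mul, Complex.norm_exp, Complex.norm_real, Real.norm_of_nonneg hsin,
    Complex.re_ofReal_mul, mul_comm (1 + Real.cos θ)]
  calc _ ≤ ‖q.eval (Real.cos θ : ℂ)‖ *
        (expConst μ * Real.exp (-(1 + |z.re|) * (1 + Real.cos θ))) * Real.sin θ := by
        gcongr
        exact exp_mul_le_expConst_mul hz (by linarith [Real.neg_one_le_cos θ])
          (by linarith [Real.cos_le_one θ])
    _ = _ := by ring

lemma norm_cosInt_le_gegenbauerNorm_zero {μ : ℝ} {z : ℂ} (hz : z.re ≤ μ) (q : ℂ[X]) :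
    ‖cosInt z q‖ ≤ 3 * expConst μ * (1 + |z.re|) ^ (-(3 / 4) : ℝ) * gegenbauerNorm 0 q := by
  have hκ : 0 < 1 + |z.re| := by positivity
  have hkernel : √(8 * (1 + |z.re|) ^ (-(3 / 2) : ℝ)) ≤ 3 * (1 + |z.re|) ^ (-(3 / 4) : ℝ) := by
    refine Real.sqrt_le_iff.mpr ⟨by positivity, ?_⟩
    rw [mul_pow, ← Real.rpow_mul_natCast hκ.le]
    norm_num
    gcongr
    norm_num
  have hcs := intervalIntegral_mul_le_sqrt_mul_sqrt
    (f := fun θ => ‖q.eval (Real.cos θ : ℂ)‖)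
    (g := fun θ => Real.exp (-(1 + |z.re|) * (1 + Real.cos θ)) * Real.sin θ) (by fun_prop)
    (by fun_prop) Real.pi_pos.le
  calc ‖cosInt z q‖ ≤ expConst μ * (gegenbauerNorm 0 q * (3 * (1 + |z.re|) ^ (-(3 / 4) : ℝ))) := by
        refine (norm_cosInt_le hz q).trans (mul_le_mul_of_nonneg_left (hcs.trans ?_)
          (expConst_pos μ).le)
        simp only [gegenbauerNorm, mul_zero, pow_zero, mul_one]
        gcongr
        exact (Real.sqrt_le_sqrt (integral_exp_neg_mul_one_add_cos_mul_sin_sq_le hκ)).trans hkernel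
    _ = _ := by ring

lemma norm_cosInt_le_gegenbauerNorm_one {μ : ℝ} {z : ℂ} (hz : z.re ≤ μ) (q : ℂ[X]) :
    ‖cosInt z q‖ ≤ 2 * expConst μ * (1 + |z.re|) ^ (-(1 / 4) : ℝ) * gegenbauerNorm 1 q := by
  have hκ : 0 < 1 + |z.re| := by positivity
  have hkernel : √(4 * (1 + |z.re|) ^ (-(1 / 2) : ℝ)) = 2 * (1 + |z.re|) ^ (-(1 / 4) : ℝ) := by
    rw [Real.sqrt_eq_iff_mul_self_eq (by positivity) (by positivity), mul_mul_mul_comm,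
      ← Real.rpow_add hκ]
    norm_num
  have hcs := intervalIntegral_mul_le_sqrt_mul_sqrt
    (f := fun θ => ‖q.eval (Real.cos θ : ℂ)‖ * Real.sin θ)
    (g := fun θ => Real.exp (-(1 + |z.re|) * (1 + Real.cos θ))) (by fun_prop) (by fun_prop)
    Real.pi_pos.le
  calc ‖cosInt z q‖
      ≤ expConst μ * ∫ θ in (0 : ℝ)..Real.pi, ‖q.eval (Real.cos θ : ℂ)‖ * Real.sin θ *
          Real.exp (-(1 + |z.re|) * (1 + Real.cos θ)) := by
        refine (norm_cosInt_le hz q).trans_eq ?_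
        congr 1
        exact intervalIntegral.integral_congr fun θ _ => by ring
    _ ≤ expConst μ * (gegenbauerNorm 1 q * (2 * (1 + |z.re|) ^ (-(1 / 4) : ℝ))) := by
        refine mul_le_mul_of_nonneg_left (hcs.trans ?_) (expConst_pos μ).le
        simp only [gegenbauerNorm, mul_one, ← hkernel, mul_pow]
        gcongr
        exact integral_exp_neg_mul_one_add_cos_sq_le hκ
    _ = _ := by ring

lemma norm_cosInt_le_of_norm_eval_mul_sin_le {μ : ℝ} {z : ℂ} (hz : z.re ≤ μ) {q : ℂ[X]} {B : ℝ}
    (hB : ∀ θ : ℝ, ‖q.eval (Real.cos θ : ℂ) * (Real.sin θ : ℂ)‖ ≤ B) :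
    ‖cosInt z q‖ ≤ 4 * expConst μ * B * (1 + |z.re|) ^ (-(1 / 2) : ℝ) := by
  have hB0 : 0 ≤ B := (norm_nonneg _).trans (hB 0)
  have hsin : ∀ θ : ℝ, ‖q.eval (Real.cos θ : ℂ)‖ * Real.sin θ ≤ B := fun θ => by
    refine (mul_le_mul_of_nonneg_left (le_abs_self _) (norm_nonneg _)).trans ?_
    simpa only [norm_mul, Complex.norm_real, Real.norm_eq_abs] using hB θ
  calc ‖cosInt z q‖
      ≤ expConst μ * ∫ θ in (0 : ℝ)..Real.pi,
          B * Real.exp (-(1 + |z.re|) * (1 + Real.cos θ)) := by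
        refine (norm_cosInt_le hz q).trans (mul_le_mul_of_nonneg_left ?_ (expConst_pos μ).le)
        refine intervalIntegral.integral_mono_on Real.pi_pos.le
          (Continuous.intervalIntegrable (by fun_prop) _ _)
          (Continuous.intervalIntegrable (by fun_prop) _ _) fun θ _ => ?_
        rw [mul_left_comm, mul_comm]
        gcongr
        exact hsin θ
    _ ≤ expConst μ * (B * (4 * (1 + |z.re|) ^ (-(1 / 2) : ℝ))) := by
        rw [intervalIntegral.integral_const_mul]
        have := expConst_pos μ
        gcongr
        exact integral_exp_neg_mul_one_add_cos_le (by positivity)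
    _ = _ := by ring

-- Two integrations by parts; the boundary terms of the first one vanish.
lemma sq_mul_norm_cosInt_le {μ : ℝ} {z : ℂ} (hz : z.re ≤ μ) {q : ℂ[X]} {A B : ℝ}
    (h1 : q.eval 1 = 0) (hneg1 : q.eval (-1) = 0)
    (hA1 : ‖(derivative q).eval 1‖ ≤ A) (hAneg1 : ‖(derivative q).eval (-1)‖ ≤ A)
    (hB : ∀ θ : ℝ, ‖q.eval (Real.cos θ : ℂ) * (Real.sin θ : ℂ)‖ ≤ B)
    (hB2 : ∀ θ : ℝ,
      ‖(derivative (derivative q)).eval (Real.cos θ : ℂ) * (Real.sin θ : ℂ)‖ ≤ B) :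
    (1 + ‖z‖) ^ 2 * ‖cosInt z q‖ ≤
      16 * expConst μ * (A + B * (1 + |z.re|) ^ (-(1 / 2) : ℝ)) := by
  have hA0 : 0 ≤ A := (norm_nonneg _).trans hA1
  have hE := expConst_pos μ
  have hparts : z ^ 2 * cosInt z q = -((derivative q).eval 1 * Complex.exp (2 * z)) +
      (derivative q).eval (-1) + cosInt z (derivative (derivative q)) := by
    have hfirst := mul_cosInt z q
    rw [h1, hneg1] at hfirst
    linear_combination z * hfirst - mul_cosInt z (derivative q)
  have hexp : ‖Complex.exp (2 * z)‖ ≤ expConst μ := by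
    rw [Complex.norm_exp, expConst]
    refine Real.exp_le_exp.mpr ?_
    simp only [Complex.mul_re, Complex.re_ofNat, Complex.im_ofNat, zero_mul, sub_zero]
    linarith [le_abs_self μ, abs_nonneg μ]
  have hzero := norm_cosInt_le_of_norm_eval_mul_sin_le hz hB
  have hsecond := norm_cosInt_le_of_norm_eval_mul_sin_le hz hB2
  have hquad : ‖z‖ ^ 2 * ‖cosInt z q‖ ≤ A * expConst μ + A * expConst μ +
      4 * expConst μ * B * (1 + |z.re|) ^ (-(1 / 2) : ℝ) := by
    rw [← norm_pow, ← norm_mul, hparts]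
    refine norm_add₃_le.trans (add_le_add (add_le_add ?_ ?_) hsecond)
    · rw [norm_neg, norm_mul]
      gcongr
    · exact hAneg1.trans (le_mul_of_one_le_right hA0 (one_le_expConst μ))
  calc (1 + ‖z‖) ^ 2 * ‖cosInt z q‖ ≤ 2 * (‖cosInt z q‖ + ‖z‖ ^ 2 * ‖cosInt z q‖) := by
        nlinarith [mul_nonneg (sq_nonneg (1 - ‖z‖)) (norm_nonneg (cosInt z q))]
    _ ≤ _ := by nlinarith [mul_nonneg hA0 hE.le]

/-! ### The error for a single Chebyshev polynomial -/

lemma norm_eval_T_cos_le (n : ℕ) (θ : ℝ) : ‖(Chebyshev.T ℂ n).eval (Real.cos θ : ℂ)‖ ≤ 1 := by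
  rw [← Chebyshev.complex_ofReal_eval_T, Chebyshev.T_real_cos, Complex.norm_real]
  exact Real.abs_cos_le_one _

lemma norm_eval_one_derivative_T (n : ℕ) :
    ‖(derivative (Chebyshev.T ℂ n)).eval 1‖ = (n : ℝ) ^ 2 := by
  rw [Chebyshev.T_derivative_eq_U, eval_mul, Chebyshev.U_eval_one]
  simp [sq]

lemma norm_eval_neg_one_derivative_T (n : ℕ) :
    ‖(derivative (Chebyshev.T ℂ n)).eval (-1)‖ = (n : ℝ) ^ 2 := by
  rw [Chebyshev.T_derivative_eq_U, eval_mul, Chebyshev.U_eval_neg_one]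
  simp [sq]

lemma norm_eval_derivative_T_mul_sin_le (n : ℕ) (θ : ℝ) :
    ‖(derivative (Chebyshev.T ℂ n)).eval (Real.cos θ : ℂ) * (Real.sin θ : ℂ)‖ ≤ n := by
  have hsin : (derivative (Chebyshev.T ℂ n)).eval (Real.cos θ : ℂ) * (Real.sin θ : ℂ) =
      ((n * Real.sin (n * θ) : ℝ) : ℂ) := by
    rw [Chebyshev.T_derivative_eq_U, eval_mul, mul_assoc, ← Chebyshev.complex_ofReal_eval_U,
      ← Complex.ofReal_mul, Chebyshev.U_real_cos θ ((n : ℤ) - 1)]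
    simp
  rw [hsin, Complex.norm_real, norm_mul, Real.norm_natCast, Real.norm_eq_abs]
  exact mul_le_of_le_one_right (Nat.cast_nonneg n) (Real.abs_sin_le_one _)

lemma norm_eval_derivative_U_mul_sin_le (θ : ℝ) (n : ℕ) :
    ‖(derivative (Chebyshev.U ℂ n)).eval (Real.cos θ : ℂ) * (Real.sin θ : ℂ)‖ ≤
      ((n : ℝ) + 1) ^ 2 := by
  induction n using Nat.twoStepInduction with
  | zero => simp
  | one =>
    have hsin : ‖(Real.sin θ : ℂ)‖ ≤ 1 :=
      (Complex.norm_real _).trans_le (Real.abs_sin_le_one θ)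
    rw [Nat.cast_one, Nat.cast_one, Chebyshev.U_one, show (2 : ℂ[X]) = C 2 from rfl,
      derivative_C_mul_X, eval_C, norm_mul, Complex.norm_ofNat]
    linarith
  | more n ih _ =>
    have hU : Chebyshev.U ℂ ((n + 2 : ℕ) : ℤ) =
        C 2 * Chebyshev.T ℂ ((n + 2 : ℕ) : ℤ) + Chebyshev.U ℂ n :=
      mod_cast Chebyshev.U_eq_two_mul_T_add_U ℂ n
    have hT := norm_eval_derivative_T_mul_sin_le (n + 2) θ
    rw [hU, derivative_add, derivative_C_mul, eval_add, eval_mul, eval_C, add_mul, mul_assoc]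
    refine (norm_add_le _ _).trans ?_
    rw [norm_mul, Complex.norm_ofNat]
    push_cast at hT ih ⊢
    nlinarith

lemma norm_eval_derivative_derivative_T_mul_sin_le (n : ℕ) (θ : ℝ) :
    ‖(derivative (derivative (Chebyshev.T ℂ n))).eval (Real.cos θ : ℂ) * (Real.sin θ : ℂ)‖ ≤
      (n : ℝ) ^ 3 := by
  rcases n with _ | n
  · simp
  · have hpred : (((n + 1 : ℕ) : ℤ) - 1) = (n : ℤ) := by push_cast; ring
    have hcast : ((((n + 1 : ℕ) : ℤ) : ℂ[X])) = C (((n + 1 : ℕ)) : ℂ) := by simp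
    rw [Chebyshev.T_derivative_eq_U, hpred, hcast, derivative_C_mul, eval_mul, eval_C, mul_assoc,
      norm_mul, Complex.norm_natCast, pow_succ', Nat.cast_succ]
    gcongr
    exact norm_eval_derivative_U_mul_sin_le θ n

lemma sq_mul_norm_cosInt_T_aliasIndex_sub_le {μ : ℝ} {z : ℂ} (hz : z.re ≤ μ) {L n : ℕ}
    (hL : 0 < L) (hn : L < n) :
    (1 + ‖z‖) ^ 2 * ‖cosInt z (Chebyshev.T ℂ (aliasIndex L n) - Chebyshev.T ℂ n)‖ ≤
      32 * expConst μ * ((n : ℝ) ^ 2 * (1 + n * (1 + |z.re|) ^ (-(1 / 2) : ℝ))) := by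
  have hle : aliasIndex L n ≤ n := (aliasIndex_le hL n).trans hn.le
  have hn1 : (1 : ℝ) ≤ n := mod_cast hL.trans hn
  have hdiff : ∀ {u v : ℂ} {j : ℕ}, ‖u‖ ≤ (aliasIndex L n : ℝ) ^ j → ‖v‖ ≤ (n : ℝ) ^ j →
      ‖u - v‖ ≤ 2 * (n : ℝ) ^ j := fun {u v j} hu hv => by
    have hpow : (aliasIndex L n : ℝ) ^ j ≤ (n : ℝ) ^ j := by gcongr
    linarith [norm_sub_le u v]
  have hmain := sq_mul_norm_cosInt_le hz
    (q := Chebyshev.T ℂ (aliasIndex L n) - Chebyshev.T ℂ n)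
    (A := 2 * (n : ℝ) ^ 2) (B := 2 * (n : ℝ) ^ 3)
    (by rw [eval_sub, Chebyshev.T_eval_one, Chebyshev.T_eval_one, sub_self])
    (by rw [eval_sub, eval_neg_one_T_aliasIndex hL, sub_self])
    (by
      rw [derivative_sub, eval_sub]
      exact hdiff (norm_eval_one_derivative_T _).le (norm_eval_one_derivative_T _).le)
    (by
      rw [derivative_sub, eval_sub]
      exact hdiff (norm_eval_neg_one_derivative_T _).le (norm_eval_neg_one_derivative_T _).le)
    (fun θ => by
      have hsin : ‖(Real.sin θ : ℂ)‖ ≤ 1 :=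
        (Complex.norm_real _).trans_le (Real.abs_sin_le_one θ)
      have htwo : ‖(Chebyshev.T ℂ (aliasIndex L n) - Chebyshev.T ℂ n).eval (Real.cos θ : ℂ)‖ ≤
          2 := by
        rw [eval_sub]
        linarith [norm_sub_le ((Chebyshev.T ℂ (aliasIndex L n)).eval (Real.cos θ : ℂ))
          ((Chebyshev.T ℂ n).eval (Real.cos θ : ℂ)), norm_eval_T_cos_le (aliasIndex L n) θ,
          norm_eval_T_cos_le n θ]
      rw [norm_mul]
      exact mul_le_mul htwo (hsin.trans (one_le_pow₀ hn1)) (norm_nonneg _) zero_le_two)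
    (fun θ => by
      rw [derivative_sub, derivative_sub, eval_sub, sub_mul]
      exact hdiff (norm_eval_derivative_derivative_T_mul_sin_le _ θ)
        (norm_eval_derivative_derivative_T_mul_sin_le _ θ))
  exact hmain.trans_eq (by ring)

/-! ### The quadrature error for polynomials -/

/-- The quadrature error `I_{L,z}(f) - I_z(f)`. -/
def quadError (L : ℕ) (z : ℂ) (f : ℝ → ℂ) : ℂ := rule L z f - exactInt z f

/-- The seminorm `‖p^(m)‖_{ϱ_m}` of a polynomial `p`. -/
def polySeminorm (m : ℕ) (p : ℂ[X]) : ℝ :=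
  weightedNorm m fun s => (derivative^[m] p).eval (s : ℂ)

/-- The constant of the error bounds for `f ∈ X_m` and `Re z ≤ μ`. It is far from optimal. -/
def errorConst (m : ℕ) (μ : ℝ) : ℝ := 32 * expConst μ * √(3 * Real.pi * (m : ℝ) ^ m)

lemma errorConst_pos (m : ℕ) (μ : ℝ) : 0 < errorConst m μ := by
  have hm : (0 : ℝ) < (m : ℝ) ^ m := mod_cast Nat.pow_self_pos
  have := expConst_pos μ
  have := Real.pi_pos
  unfold errorConst
  positivity

lemma continuous_weight {m : ℕ} (hm : 1 ≤ m) : Continuous (weight m) := by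
  have hexp : (0 : ℝ) ≤ (m : ℝ) - 1 / 2 := by
    have : (1 : ℝ) ≤ m := mod_cast hm
    linarith
  exact (Real.continuous_rpow_const hexp).comp (by fun_prop)

lemma continuous_norm_eval_sq_mul_weight {m : ℕ} (hm : 1 ≤ m) (q : ℂ[X]) :
    Continuous fun s : ℝ => ‖q.eval (s : ℂ)‖ ^ 2 * weight m s :=
  Continuous.mul (by fun_prop) (continuous_weight hm)

lemma weight_nonneg (m : ℕ) {s : ℝ} (hs : s ∈ Icc (0 : ℝ) 2) : 0 ≤ weight m s :=
  Real.rpow_nonneg (mul_nonneg hs.1 (by linarith [hs.2])) _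

lemma sin_mul_weight_one_add_cos {m : ℕ} (hm : 1 ≤ m) {θ : ℝ} (hθ : 0 ≤ Real.sin θ) :
    Real.sin θ * weight m (1 + Real.cos θ) = Real.sin θ ^ (2 * m) := by
  have hsin : (1 + Real.cos θ) * (2 - (1 + Real.cos θ)) = Real.sin θ ^ 2 := by
    rw [Real.sin_sq]; ring
  rw [weight, hsin]
  rcases hθ.eq_or_lt with h | h
  · rw [← h, zero_mul, zero_pow (by omega)]
  · rw [← Real.rpow_natCast_mul h.le, ← Real.rpow_one_add' h.le, ← Real.rpow_natCast]
    · congr 1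
      push_cast
      ring
    · have : (1 : ℝ) ≤ m := mod_cast hm
      push_cast
      linarith

lemma weightedNorm_comp_X_sub_one {m : ℕ} (hm : 1 ≤ m) (q : ℂ[X]) :
    weightedNorm m (fun s => (q.comp (X - C 1)).eval (s : ℂ)) = gegenbauerNorm m q := by
  rw [weightedNorm, gegenbauerNorm, ← integral_Ioc_eq_integral_Ioo,
    ← intervalIntegral.integral_of_le zero_le_two,
    ← integral_sin_smul_comp_one_add_cos (continuous_norm_eval_sq_mul_weight hm _)]
  congr 1
  refine intervalIntegral.integral_congr fun θ hθ => ?_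
  rw [uIcc_of_le Real.pi_pos.le] at hθ
  simp only [eval_comp, eval_sub, eval_X, eval_C, Complex.ofReal_add, Complex.ofReal_one,
    add_sub_cancel_left, smul_eq_mul,
    ← sin_mul_weight_one_add_cos hm (Real.sin_nonneg_of_nonneg_of_le_pi hθ.1 hθ.2)]
  ring

lemma iterate_derivative_comp_of_derivative_eq_C {R : Type*} [CommSemiring R] {g : R[X]} {r : R}
    (hg : derivative g = C r) (p : R[X]) (m : ℕ) :
    derivative^[m] (p.comp g) = C (r ^ m) * (derivative^[m] p).comp g := by
  induction m with
  | zero => simp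
  | succ m ih =>
    rw [Function.iterate_succ_apply', ih, derivative_C_mul, derivative_comp, hg,
      Function.iterate_succ_apply', ← mul_assoc, ← C_mul, pow_succ]

lemma polySeminorm_comp_X_sub_one {m : ℕ} (hm : 1 ≤ m) (q : ℂ[X]) :
    polySeminorm m (q.comp (X - C 1)) = gegenbauerNorm m (derivative^[m] q) := by
  have hder : derivative (X - C 1 : ℂ[X]) = C 1 := by rw [derivative_X_sub_C, C_1]
  rw [polySeminorm, iterate_derivative_comp_of_derivative_eq_C hder, one_pow, C_1, one_mul, ← C_1,
    weightedNorm_comp_X_sub_one hm]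

lemma exists_eq_chebSum_comp (p : ℂ[X]) :
    ∃ (s : Finset ℕ) (a : ℕ → ℂ), p = (chebSum s a).comp (X - C 1) := by
  obtain ⟨N, a, h⟩ := exists_eq_chebSum (p.comp (X + C 1))
  exact ⟨Finset.range N, a, by rw [← h, comp_assoc]; simp⟩

lemma quadError_chebSum {L : ℕ} (hL : 0 < L) (z : ℂ) (s : Finset ℕ) (a : ℕ → ℂ) :
    quadError L z (fun x : ℝ => ((chebSum s a).comp (X - C 1)).eval (x : ℂ)) =
      cosInt z (aliasError L s a) := by
  rw [quadError, rule, exactInt, interp_chebSum hL, integral_comp_sub_one_mul_exp,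
    integral_comp_sub_one_mul_exp, cosInt_add, add_sub_cancel_left]

lemma norm_quadError_polynomial_le {μ : ℝ} {L m : ℕ} (hL : 0 < L) (hm : 1 ≤ m)
    (hmL : m ≤ L + 1) {z : ℂ} (hz : z.re ≤ μ) (p : ℂ[X]) :
    ‖quadError L z (fun x : ℝ => p.eval (x : ℂ))‖ ≤
      errorConst m μ * (L : ℝ) ^ (1 - (m : ℝ)) * (1 + |z.re|) ^ (-(3 / 4) : ℝ) * (1 / L) *
        polySeminorm m p := by
  obtain ⟨s, a, rfl⟩ := exists_eq_chebSum_comp p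
  have hL' : (0 : ℝ) < L := mod_cast hL
  have hE := expConst_pos μ
  rw [quadError_chebSum hL, polySeminorm_comp_X_sub_one hm, errorConst, Real.rpow_sub hL',
    Real.rpow_one, Real.rpow_natCast]
  have halias := gegenbauerNorm_iterate_derivative_aliasError_le hL hm hmL (Nat.zero_le m) s a
  rw [Function.iterate_zero_apply] at halias
  calc ‖cosInt z (aliasError L s a)‖
      ≤ 32 * expConst μ * (1 + |z.re|) ^ (-(3 / 4) : ℝ) *
          (√(3 * Real.pi * (m : ℝ) ^ m) * ((L : ℝ) ^ 0 / (L : ℝ) ^ m) *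
            gegenbauerNorm m (derivative^[m] (chebSum s a))) := by
        refine (norm_cosInt_le_gegenbauerNorm_zero hz _).trans ?_
        gcongr
        · exact Real.sqrt_nonneg _
        · norm_num
    _ = _ := by field_simp

lemma norm_mul_norm_quadError_polynomial_le {μ : ℝ} {L m : ℕ} (hL : 0 < L) (hm : 1 ≤ m)
    (hmL : m ≤ L + 1) {z : ℂ} (hz : z.re ≤ μ) (p : ℂ[X]) :
    ‖z‖ * ‖quadError L z (fun x : ℝ => p.eval (x : ℂ))‖ ≤
      errorConst m μ * (L : ℝ) ^ (1 - (m : ℝ)) * (1 + |z.re|) ^ (-(1 / 4) : ℝ) *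
        polySeminorm m p := by
  obtain ⟨s, a, rfl⟩ := exists_eq_chebSum_comp p
  have hL' : (0 : ℝ) < L := mod_cast hL
  have hE := expConst_pos μ
  rw [quadError_chebSum hL, polySeminorm_comp_X_sub_one hm, errorConst, Real.rpow_sub hL',
    Real.rpow_one, Real.rpow_natCast]
  have hparts : z * cosInt z (aliasError L s a) = -cosInt z (derivative (aliasError L s a)) := by
    rw [mul_cosInt, eval_one_aliasError, eval_neg_one_aliasError hL, zero_mul, sub_zero, zero_sub]
  have halias := gegenbauerNorm_iterate_derivative_aliasError_le hL hm hmL hm s a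
  rw [Function.iterate_one] at halias
  rw [← norm_mul, hparts, norm_neg]
  calc ‖cosInt z (derivative (aliasError L s a))‖
      ≤ 32 * expConst μ * (1 + |z.re|) ^ (-(1 / 4) : ℝ) *
          (√(3 * Real.pi * (m : ℝ) ^ m) * ((L : ℝ) ^ 1 / (L : ℝ) ^ m) *
            gegenbauerNorm m (derivative^[m] (chebSum s a))) := by
        refine (norm_cosInt_le_gegenbauerNorm_one hz _).trans ?_
        gcongr
        · exact Real.sqrt_nonneg _
        · norm_num
    _ = _ := by ring

lemma sum_sq_pow_div_pow_le {L m j : ℕ} (hL : 0 < L) (hjm : j < m) {s : Finset ℕ}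
    (hs : ∀ n ∈ s, L < n) :
    ∑ n ∈ s, ((n : ℝ) ^ j / (n : ℝ) ^ m) ^ 2 ≤ (√2 * (L : ℝ) ^ (j + 1 / 2 - m : ℝ)) ^ 2 := by
  obtain ⟨i, rfl⟩ := Nat.exists_eq_add_of_lt hjm
  have hL' : (0 : ℝ) < L := mod_cast hL
  have hsum : ∑ n ∈ s, ((n : ℝ) ^ 2)⁻¹ ≤ 2 / L := by
    have hsub : s ⊆ Finset.Ioo L (s.sup id + 1) := fun n hn =>
      Finset.mem_Ioo.mpr ⟨hs n hn, Nat.lt_succ_of_le (Finset.le_sup (f := id) hn)⟩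
    calc ∑ n ∈ s, ((n : ℝ) ^ 2)⁻¹ ≤ ∑ n ∈ Finset.Ioo L (s.sup id + 1), ((n : ℝ) ^ 2)⁻¹ :=
          Finset.sum_le_sum_of_subset_of_nonneg hsub fun _ _ _ => by positivity
      _ ≤ 2 / (L + 1) := sum_Ioo_inv_sq_le L _
      _ ≤ 2 / L := by gcongr; linarith
  have hterm : ∀ n ∈ s, ((n : ℝ) ^ j / (n : ℝ) ^ (j + i + 1)) ^ 2 ≤
      ((L : ℝ) ^ (2 * i))⁻¹ * ((n : ℝ) ^ 2)⁻¹ := fun n hn => by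
    have hn0 : (0 : ℝ) < n := mod_cast hL.trans (hs n hn)
    have hLn : (L : ℝ) ≤ n := mod_cast (hs n hn).le
    calc ((n : ℝ) ^ j / (n : ℝ) ^ (j + i + 1)) ^ 2 = ((n : ℝ) ^ (2 * i))⁻¹ * ((n : ℝ) ^ 2)⁻¹ := by
          field_simp
          ring
      _ ≤ _ := by gcongr
  have hrpow : ((L : ℝ) ^ (j + 1 / 2 - (j + i + 1 : ℕ) : ℝ)) ^ 2 = ((L : ℝ) ^ (2 * i))⁻¹ / L := by
    rw [← Real.rpow_mul_natCast hL'.le, ← Real.rpow_natCast, ← Real.rpow_neg hL'.le,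
      ← Real.rpow_sub_one hL'.ne']
    congr 1
    push_cast
    ring
  rw [mul_pow, Real.sq_sqrt zero_le_two, hrpow]
  refine (Finset.sum_le_sum hterm).trans ?_
  rw [← Finset.mul_sum]
  calc _ ≤ ((L : ℝ) ^ (2 * i))⁻¹ * (2 / L) := by gcongr
    _ = _ := by ring

lemma sum_pow_mul_norm_le {L m j : ℕ} (hL : 0 < L) (hjm : j < m) {s : Finset ℕ}
    (hs : ∀ n ∈ s, L < n) (a : ℕ → ℂ) :
    ∑ n ∈ s, (n : ℝ) ^ j * ‖a n‖ ≤ √2 * (L : ℝ) ^ (j + 1 / 2 - m : ℝ) *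
      √(∑ n ∈ s, (n : ℝ) ^ (2 * m) * ‖a n‖ ^ 2) := by
  have hsplit : ∑ n ∈ s, (n : ℝ) ^ j * ‖a n‖ =
      ∑ n ∈ s, (n : ℝ) ^ j / (n : ℝ) ^ m * ((n : ℝ) ^ m * ‖a n‖) :=
    Finset.sum_congr rfl fun n hn => by
      have hn0 : (n : ℝ) ≠ 0 := mod_cast (hL.trans (hs n hn)).ne'
      field_simp
  have hsq : ∀ n : ℕ, ((n : ℝ) ^ m * ‖a n‖) ^ 2 = (n : ℝ) ^ (2 * m) * ‖a n‖ ^ 2 := fun n => by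
    rw [mul_pow, pow_mul']
  rw [hsplit]
  refine (Real.sum_mul_le_sqrt_mul_sqrt _ _ _).trans ?_
  simp only [hsq]
  gcongr
  exact Real.sqrt_le_iff.mpr ⟨by positivity, sum_sq_pow_div_pow_le hL hjm hs⟩

lemma sq_mul_norm_cosInt_aliasError_le {μ : ℝ} {L : ℕ} (hL : 0 < L) {z : ℂ} (hz : z.re ≤ μ)
    {s : Finset ℕ} (hs : ∀ n ∈ s, L < n) (a : ℕ → ℂ) :
    (1 + ‖z‖) ^ 2 * ‖cosInt z (aliasError L s a)‖ ≤ 32 * expConst μ *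
      ((1 + (1 + |z.re|) ^ (-(1 / 2) : ℝ) * L) / L) * ∑ n ∈ s, (n : ℝ) ^ 3 * ‖a n‖ := by
  have hL' : (0 : ℝ) < L := mod_cast hL
  have hE := expConst_pos μ
  set τ := (1 + |z.re|) ^ (-(1 / 2) : ℝ)
  rw [aliasError, cosInt_sum, Finset.mul_sum]
  refine (mul_le_mul_of_nonneg_left (norm_sum_le _ _) (sq_nonneg _)).trans ?_
  rw [Finset.mul_sum]
  refine Finset.sum_le_sum fun n hn => ?_
  have hLn : (L : ℝ) ≤ n := mod_cast (hs n hn).le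
  have hcubic : (n : ℝ) ^ 2 * (1 + n * τ) ≤ (1 + τ * L) / L * (n : ℝ) ^ 3 := by
    calc (n : ℝ) ^ 2 * (1 + n * τ) ≤ (n : ℝ) ^ 2 * (n / L + n * τ) := by
          gcongr
          exact (one_le_div hL').mpr hLn
      _ = _ := by field_simp
  calc (1 + ‖z‖) ^ 2 * ‖a n * cosInt z (Chebyshev.T ℂ (aliasIndex L n) - Chebyshev.T ℂ n)‖
      = (1 + ‖z‖) ^ 2 * ‖cosInt z (Chebyshev.T ℂ (aliasIndex L n) - Chebyshev.T ℂ n)‖ * ‖a n‖ := by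
        rw [norm_mul]; ring
    _ ≤ 32 * expConst μ * ((1 + τ * L) / L * (n : ℝ) ^ 3) * ‖a n‖ := by
        refine mul_le_mul_of_nonneg_right ?_ (norm_nonneg _)
        exact (sq_mul_norm_cosInt_T_aliasIndex_sub_le hz hL (hs n hn)).trans (by gcongr)
    _ = _ := by ring

lemma sq_mul_norm_quadError_polynomial_le {μ : ℝ} {L m : ℕ} (hL : 0 < L) (hm : 4 ≤ m)
    (hmL : m ≤ L + 1) {z : ℂ} (hz : z.re ≤ μ) (p : ℂ[X]) :
    (1 + ‖z‖) ^ 2 * ‖quadError L z (fun x : ℝ => p.eval (x : ℂ))‖ ≤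
      errorConst m μ * (L : ℝ) ^ (5 / 2 - (m : ℝ)) *
        (1 + (1 + |z.re|) ^ (-(1 / 2) : ℝ) * L) * polySeminorm m p := by
  obtain ⟨s, a, rfl⟩ := exists_eq_chebSum_comp p
  have hL' : (0 : ℝ) < L := mod_cast hL
  have hE := expConst_pos μ
  have hlt : ∀ n ∈ s.filter (L < ·), L < n := fun n hn => (Finset.mem_filter.mp hn).2
  rw [quadError_chebSum hL, polySeminorm_comp_X_sub_one (by omega), errorConst]
  set N := gegenbauerNorm m (derivative^[m] (chebSum s a))
  have hN0 : 0 ≤ N := Real.sqrt_nonneg _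
  set τ := (1 + |z.re|) ^ (-(1 / 2) : ℝ)
  have hcoeff : √(∑ n ∈ s with L < n, (n : ℝ) ^ (2 * m) * ‖a n‖ ^ 2) ≤ √((m : ℝ) ^ m) * N := by
    rw [← Real.sqrt_sq hN0, ← Real.sqrt_mul (by positivity)]
    exact Real.sqrt_le_sqrt (sum_pow_mul_norm_sq_le (Finset.filter_subset _ _)
      (fun n hn => by have := hlt n hn; omega) a)
  have hconst : √2 * √((m : ℝ) ^ m) ≤ √(3 * Real.pi * (m : ℝ) ^ m) := by
    rw [← Real.sqrt_mul zero_le_two]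
    gcongr
    linarith [Real.pi_gt_three]
  have hrpow : (L : ℝ) ^ ((3 : ℕ) + 1 / 2 - (m : ℝ)) = (L : ℝ) ^ (5 / 2 - (m : ℝ)) * L := by
    rw [← Real.rpow_add_one hL'.ne']
    norm_num
    ring_nf
  calc (1 + ‖z‖) ^ 2 * ‖cosInt z (aliasError L s a)‖
      ≤ 32 * expConst μ * ((1 + τ * L) / L) * ∑ n ∈ s with L < n, (n : ℝ) ^ 3 * ‖a n‖ := by
        rw [← aliasError_filter_lt hL]
        exact sq_mul_norm_cosInt_aliasError_le hL hz hlt a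
    _ ≤ 32 * expConst μ * ((1 + τ * L) / L) * (√2 * ((L : ℝ) ^ (5 / 2 - (m : ℝ)) * L) *
          (√((m : ℝ) ^ m) * N)) := by
        rw [← hrpow]
        gcongr
        exact (sum_pow_mul_norm_le hL (show 3 < m by omega) hlt a).trans (by gcongr)
    _ = 32 * expConst μ * (√2 * √((m : ℝ) ^ m)) * (L : ℝ) ^ (5 / 2 - (m : ℝ)) * (1 + τ * L) *
          N := by
        field_simp
    _ ≤ _ := by gcongr

/-! ### Absolutely continuous complex functions -/

lemma absolutelyContinuousOnInterval_lipschitzWith_comp {X Y : Type*} [PseudoMetricSpace X]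
    [PseudoMetricSpace Y] {f : ℝ → X} {a b : ℝ} (hf : AbsolutelyContinuousOnInterval f a b)
    {K : NNReal} {g : X → Y} (hg : LipschitzWith K g) :
    AbsolutelyContinuousOnInterval (g ∘ f) a b := by
  unfold AbsolutelyContinuousOnInterval at hf ⊢
  refine squeeze_zero (fun _ => Finset.sum_nonneg fun _ _ => dist_nonneg) (fun E => ?_)
    (by simpa using hf.const_mul (K : ℝ))
  rw [Finset.mul_sum]
  exact Finset.sum_le_sum fun i _ => hg.dist_le_mul _ _

lemma absolutelyContinuousOnInterval_re {f : ℝ → ℂ} {a b : ℝ}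
    (hf : AbsolutelyContinuousOnInterval f a b) :
    AbsolutelyContinuousOnInterval (fun x => (f x).re) a b :=
  absolutelyContinuousOnInterval_lipschitzWith_comp hf Complex.reCLM.lipschitz

lemma absolutelyContinuousOnInterval_im {f : ℝ → ℂ} {a b : ℝ}
    (hf : AbsolutelyContinuousOnInterval f a b) :
    AbsolutelyContinuousOnInterval (fun x => (f x).im) a b :=
  absolutelyContinuousOnInterval_lipschitzWith_comp hf Complex.imCLM.lipschitz

lemma deriv_eq_deriv_re_add_deriv_im {f : ℝ → ℂ} {x : ℝ}
    (hre : DifferentiableAt ℝ (fun x => (f x).re) x)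
    (him : DifferentiableAt ℝ (fun x => (f x).im) x) :
    deriv f x = ((deriv (fun x => (f x).re) x : ℝ) : ℂ) +
      deriv (fun x => (f x).im) x * Complex.I := by
  have h := hre.hasDerivAt.ofReal_comp.fun_add (him.hasDerivAt.ofReal_comp.mul_const Complex.I)
  simp only [Complex.re_add_im] at h
  exact h.deriv

lemma intervalIntegrable_deriv_and_integral_deriv {f : ℝ → ℂ} {a b : ℝ}
    (hf : AbsolutelyContinuousOnInterval f a b) :
    IntervalIntegrable (deriv f) volume a b ∧ ∫ x in a..b, deriv f x = f b - f a := by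
  have hre := absolutelyContinuousOnInterval_re hf
  have him := absolutelyContinuousOnInterval_im hf
  have hae : ∀ᵐ x : ℝ, x ∈ uIoc a b → ((deriv (fun x => (f x).re) x : ℝ) : ℂ) +
      deriv (fun x => (f x).im) x * Complex.I = deriv f x := by
    filter_upwards [hre.ae_differentiableAt, him.ae_differentiableAt] with x hre' him' hx
    exact (deriv_eq_deriv_re_add_deriv_im (hre' (uIoc_subset_uIcc hx))
      (him' (uIoc_subset_uIcc hx))).symm
  have hire : IntervalIntegrable (fun x => ((deriv (fun x => (f x).re) x : ℝ) : ℂ)) volume a b :=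
    ⟨hre.intervalIntegrable_deriv.1.ofReal, hre.intervalIntegrable_deriv.2.ofReal⟩
  have hiim : IntervalIntegrable (fun x => deriv (fun x => (f x).im) x * Complex.I) volume a b :=
    ⟨him.intervalIntegrable_deriv.1.ofReal.mul_const _,
      him.intervalIntegrable_deriv.2.ofReal.mul_const _⟩
  constructor
  · exact (hire.add hiim).congr_ae ((ae_restrict_iff' measurableSet_uIoc).mpr hae)
  · rw [← intervalIntegral.integral_congr_ae hae, intervalIntegral.integral_add hire hiim,
      intervalIntegral.integral_mul_const, intervalIntegral.integral_ofReal,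
      intervalIntegral.integral_ofReal, hre.integral_deriv_eq_sub, him.integral_deriv_eq_sub]
    apply Complex.ext <;> simp

/-! ### Approximation by polynomials together with a derivative -/

lemma exists_polynomial_norm_sub_le {a b : ℝ} {h : ℝ → ℂ} (hh : ContinuousOn h (Icc a b)) {ε : ℝ}
    (hε : 0 < ε) : ∃ q : ℂ[X], ∀ x ∈ Icc a b, ‖h x - q.eval (x : ℂ)‖ ≤ ε := by
  obtain ⟨p, hp⟩ := exists_polynomial_near_of_continuousOn a b (fun x => (h x).re)
    (Complex.continuous_re.comp_continuousOn hh) (ε / 2) (half_pos hε)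
  obtain ⟨q, hq⟩ := exists_polynomial_near_of_continuousOn a b (fun x => (h x).im)
    (Complex.continuous_im.comp_continuousOn hh) (ε / 2) (half_pos hε)
  refine ⟨p.map (algebraMap ℝ ℂ) + C Complex.I * q.map (algebraMap ℝ ℂ), fun x hx => ?_⟩
  have heval : ∀ p : ℝ[X], (p.map (algebraMap ℝ ℂ)).eval (x : ℂ) = (p.eval x : ℝ) := fun p => by
    rw [eval_map]
    exact eval₂_at_apply (algebraMap ℝ ℂ) x
  have hsplit : h x - (p.map (algebraMap ℝ ℂ) + C Complex.I * q.map (algebraMap ℝ ℂ)).eval (x : ℂ) =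
      ((h x).re - p.eval x : ℝ) + ((h x).im - q.eval x : ℝ) * Complex.I := by
    rw [eval_add, eval_mul, eval_C, heval, heval]
    apply Complex.ext <;> simp
  rw [hsplit]
  refine (norm_add_le _ _).trans ?_
  rw [norm_mul, Complex.norm_I, mul_one, Complex.norm_real, Complex.norm_real, norm_sub_rev,
    norm_sub_rev (h x).im, Real.norm_eq_abs, Real.norm_eq_abs]
  linarith [hp x hx, hq x hx]

lemma exists_polynomial_eLpNorm_sub_le {μ : Measure ℝ} [IsLocallyFiniteMeasure μ] {a b : ℝ}
    {p : ENNReal} (hp : 1 ≤ p) (hp' : p ≠ ⊤) {g : ℝ → ℂ} (hg : MemLp g p (μ.restrict (Icc a b)))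
    {ε : ENNReal} (hε : ε ≠ 0) :
    ∃ q : ℂ[X], eLpNorm (fun x => g x - q.eval (x : ℂ)) p (μ.restrict (Icc a b)) ≤ ε := by
  set ν := μ.restrict (Icc a b)
  have : IsFiniteMeasure ν := ⟨by simpa [ν] using isCompact_Icc.measure_lt_top⟩
  have hε2 : ε / 2 ≠ 0 := (ENNReal.half_pos hε).ne'
  have hK : ν univ ^ p.toReal⁻¹ ≠ ⊤ :=
    ENNReal.rpow_ne_top_of_nonneg (by positivity) (measure_ne_top _ _)
  obtain ⟨δ, hδ, hδK⟩ := ENNReal.exists_nnreal_pos_mul_lt hK hε2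
  obtain ⟨h, hcont, hgh, hmem⟩ :
      ∃ h : ℝ → ℂ, Continuous h ∧ eLpNorm (g - h) p ν ≤ ε / 2 ∧ MemLp h p ν := by
    obtain ⟨h, hgh, hmem⟩ := hg.exists_boundedContinuous_eLpNorm_sub_le hp' hε2
    exact ⟨h, h.continuous, hgh, hmem⟩
  obtain ⟨q, hq⟩ := exists_polynomial_norm_sub_le (a := a) (b := b) hcont.continuousOn
    (NNReal.coe_pos.mpr hδ)
  have hqm : AEStronglyMeasurable (fun x : ℝ => q.eval (x : ℂ)) ν :=
    Continuous.aestronglyMeasurable (by fun_prop)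
  have hhq : eLpNorm (h - fun x : ℝ => q.eval (x : ℂ)) p ν ≤ ε / 2 := by
    refine (eLpNorm_le_of_ae_bound ((ae_restrict_iff' measurableSet_Icc).mpr
      (Filter.Eventually.of_forall hq))).trans ?_
    rw [ENNReal.ofReal_coe_nnreal, mul_comm]
    exact hδK.le
  refine ⟨q, ?_⟩
  calc eLpNorm (fun x => g x - q.eval (x : ℂ)) p ν
      = eLpNorm ((g - h) + (h - fun x : ℝ => q.eval (x : ℂ))) p ν := by
        rw [sub_add_sub_cancel]; rfl
    _ ≤ ε / 2 + ε / 2 :=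
        (eLpNorm_add_le (hg.1.sub hmem.1) (hmem.1.sub hqm) hp).trans (add_le_add hgh hhq)
    _ = ε := ENNReal.add_halves ε

lemma exists_derivative_eq {K : Type*} [Field K] [CharZero K] (q : K[X]) :
    ∃ Q : K[X], derivative Q = q := by
  induction q using Polynomial.induction_on' with
  | add p q hp hq =>
    obtain ⟨P, rfl⟩ := hp
    obtain ⟨Q, rfl⟩ := hq
    exact ⟨P + Q, derivative_add⟩
  | monomial n c =>
    refine ⟨monomial (n + 1) (c / ((n + 1 : ℕ) : K)), ?_⟩
    rw [derivative_monomial, div_mul_cancel₀ _ (Nat.cast_ne_zero.mpr n.succ_ne_zero),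
      Nat.add_sub_cancel]

lemma exists_derivative_eq_eval_eq {K : Type*} [Field K] [CharZero K] (q : K[X]) (x c : K) :
    ∃ Q : K[X], derivative Q = q ∧ Q.eval x = c := by
  obtain ⟨Q, hQ⟩ := exists_derivative_eq q
  exact ⟨Q + C (c - Q.eval x), by simp [hQ], by simp⟩

lemma hasDerivAt_eval_ofReal (q : ℂ[X]) (x : ℝ) :
    HasDerivAt (fun x : ℝ => q.eval (x : ℂ)) ((derivative q).eval (x : ℂ)) x :=
  (q.hasDerivAt (x : ℂ)).comp_ofReal

lemma sub_eval_eq_integral_deriv_sub {a b : ℝ} {f : ℝ → ℂ}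
    (hf : AbsolutelyContinuousOnInterval f a b) {q : ℂ[X]} (hq : q.eval (a : ℂ) = f a) :
    f b - q.eval (b : ℂ) = ∫ t in a..b, (deriv f t - (derivative q).eval (t : ℂ)) := by
  obtain ⟨hint, hftc⟩ := intervalIntegrable_deriv_and_integral_deriv hf
  have hqint : IntervalIntegrable (fun t : ℝ => (derivative q).eval (t : ℂ)) volume a b :=
    Continuous.intervalIntegrable (by fun_prop) _ _
  rw [intervalIntegral.integral_sub hint hqint, hftc,
    intervalIntegral.integral_eq_sub_of_hasDerivAt (fun t _ => hasDerivAt_eval_ofReal q t) hqint,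
    hq, sub_sub_sub_cancel_right]

lemma enorm_intervalIntegral_le_eLpNorm_mul {E : Type*} [NormedAddCommGroup E] [NormedSpace ℝ E]
    {a b x : ℝ} (hx : x ∈ Icc a b) {p : ENNReal} (hp : 1 ≤ p) {u : ℝ → E}
    (hu : AEStronglyMeasurable u (volume.restrict (Icc a b))) :
    ‖∫ t in a..x, u t‖ₑ ≤ eLpNorm u p (volume.restrict (Icc a b)) *
      volume.restrict (Icc a b) univ ^ (1 - 1 / p.toReal) := by
  rw [intervalIntegral.integral_of_le hx.1]
  calc ‖∫ t in Ioc a x, u t‖ₑ ≤ ∫⁻ t in Ioc a x, ‖u t‖ₑ := enorm_integral_le_lintegral_enorm _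
    _ ≤ ∫⁻ t in Icc a b, ‖u t‖ₑ :=
        lintegral_mono_set (Ioc_subset_Icc_self.trans (Icc_subset_Icc_right hx.2))
    _ = eLpNorm u 1 (volume.restrict (Icc a b)) := eLpNorm_one_eq_lintegral_enorm.symm
    _ ≤ _ := by simpa using eLpNorm_le_eLpNorm_mul_rpow_measure_univ hp hu

lemma exists_polynomial_approx_of_absolutelyContinuousOnInterval {a b : ℝ} (hab : a ≤ b)
    {p : ENNReal} (hp : 1 ≤ p) (hp' : p ≠ ⊤) {f : ℝ → ℂ}
    (hf : AbsolutelyContinuousOnInterval f a b)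
    (hmem : MemLp (deriv f) p (volume.restrict (Icc a b))) {ε : ℝ} (hε : 0 < ε) :
    ∃ q : ℂ[X], (∀ x ∈ Icc a b, ‖f x - q.eval (x : ℂ)‖ ≤ ε) ∧
      eLpNorm (fun x => deriv f x - (derivative q).eval (x : ℂ)) p (volume.restrict (Icc a b)) ≤
        ENNReal.ofReal ε := by
  set K := volume.restrict (Icc a b) univ ^ (1 - 1 / p.toReal)
  have hK : 1 + K ≠ ⊤ := by
    have hexp : 0 ≤ 1 - 1 / p.toReal := by
      have : 1 ≤ p.toReal := by simpa using ENNReal.toReal_mono hp' hp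
      exact sub_nonneg.mpr (div_le_one_of_le₀ this (zero_le_one.trans this))
    exact ENNReal.add_ne_top.mpr
      ⟨ENNReal.one_ne_top, ENNReal.rpow_ne_top_of_nonneg hexp (measure_ne_top _ _)⟩
  obtain ⟨δ, hδ, hδK⟩ := ENNReal.exists_nnreal_pos_mul_lt hK (ENNReal.ofReal_pos.mpr hε).ne'
  obtain ⟨q, hq⟩ := exists_polynomial_eLpNorm_sub_le hp hp' hmem
    (ENNReal.coe_ne_zero.mpr hδ.ne')
  obtain ⟨Q, rfl, hQ⟩ := exists_derivative_eq_eval_eq q (a : ℂ) (f a)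
  have hmeas : AEStronglyMeasurable (fun x : ℝ => deriv f x - (derivative Q).eval (x : ℂ))
      (volume.restrict (Icc a b)) :=
    hmem.1.sub (Continuous.aestronglyMeasurable (by fun_prop))
  refine ⟨Q, fun x hx => ?_, hq.trans (le_trans ?_ hδK.le)⟩
  · have hACx : AbsolutelyContinuousOnInterval f a x :=
      hf.mono (uIcc_subset_uIcc_left (by rwa [uIcc_of_le hab]))
    rw [← ENNReal.ofReal_le_ofReal_iff hε.le, ofReal_norm, sub_eval_eq_integral_deriv_sub hACx hQ]
    calc _ ≤ _ := enorm_intervalIntegral_le_eLpNorm_mul hx hp hmeas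
      _ ≤ δ * (1 + K) := mul_le_mul' hq le_add_self
      _ ≤ _ := hδK.le
  · exact le_mul_of_one_le_right' le_self_add

lemma exists_polynomial_approx_of_contDiffOn {a b : ℝ} (hab : a ≤ b) {s : Set ℝ} (hs : IsOpen s)
    (hsub : Icc a b ⊆ s) {p : ENNReal} (hp : 1 ≤ p) (hp' : p ≠ ⊤) (n : ℕ) {f : ℝ → ℂ}
    (hf : ContDiffOn ℝ n f s) (hAC : AbsolutelyContinuousOnInterval (iteratedDeriv n f) a b)
    (hmem : MemLp (iteratedDeriv (n + 1) f) p (volume.restrict (Icc a b))) {ε : ℝ} (hε : 0 < ε) :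
    ∃ q : ℂ[X], (∀ x ∈ Icc a b, ‖f x - q.eval (x : ℂ)‖ ≤ ε) ∧
      eLpNorm (fun x => iteratedDeriv (n + 1) f x - (derivative^[n + 1] q).eval (x : ℂ)) p
        (volume.restrict (Icc a b)) ≤ ENNReal.ofReal ε := by
  induction n generalizing f ε with
  | zero =>
    rw [zero_add, iteratedDeriv_one] at hmem ⊢
    exact exists_polynomial_approx_of_absolutelyContinuousOnInterval hab hp hp'
      (by rwa [iteratedDeriv_zero] at hAC) hmem hε
  | succ n ih =>
    have hf' : ContDiffOn ℝ ((n : WithTop ℕ∞) + 1) f s := mod_cast hf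
    obtain ⟨hdiff, -, hf'⟩ := (contDiffOn_succ_iff_deriv_of_isOpen hs).mp hf'
    rw [iteratedDeriv_succ'] at hAC hmem
    have hba : 0 < 1 + (b - a) := by linarith
    obtain ⟨q, hsup, hnorm⟩ := ih hf' hAC hmem (div_pos hε hba)
    obtain ⟨Q, rfl, hQ⟩ := exists_derivative_eq_eval_eq q (a : ℂ) (f a)
    refine ⟨Q, fun x hx => ?_, ?_⟩
    · have hder : ∀ t ∈ Icc a b, HasDerivAt (fun t : ℝ => f t - Q.eval (t : ℂ))
          (deriv f t - (derivative Q).eval (t : ℂ)) t := fun t ht =>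
        (hdiff.differentiableAt (hs.mem_nhds (hsub ht))).hasDerivAt.sub
          (hasDerivAt_eval_ofReal Q t)
      have hmvt := (convex_Icc a b).norm_image_sub_le_of_norm_hasDerivWithin_le
        (fun t ht => (hder t ht).hasDerivWithinAt) hsup ⟨le_rfl, hab⟩ hx
      rw [hQ, sub_self, sub_zero, Real.norm_of_nonneg (sub_nonneg.mpr hx.1)] at hmvt
      refine hmvt.trans ?_
      rw [div_mul_eq_mul_div, div_le_iff₀ hba]
      gcongr
      linarith [hx.2]
    · rw [iteratedDeriv_succ', Function.iterate_succ_apply]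
      exact hnorm.trans (ENNReal.ofReal_le_ofReal (div_le_self hε.le (by linarith)))

/-! ### Density of polynomials among admissible functions -/

lemma weight_le_weight_dilate {m : ℕ} (hm : 1 ≤ m) {r s : ℝ} (hr : r ∈ Icc (0 : ℝ) 1)
    (hs : s ∈ Icc (0 : ℝ) 2) : weight m s ≤ weight m (r * s + (1 - r)) := by
  have hm' : (1 : ℝ) ≤ m := mod_cast hm
  refine Real.rpow_le_rpow (mul_nonneg hs.1 (by linarith [hs.2])) ?_ (by linarith)
  have hsq : 0 ≤ (1 - r ^ 2) * (s - 1) ^ 2 :=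
    mul_nonneg (sub_nonneg.mpr (pow_le_one₀ hr.1 hr.2)) (sq_nonneg _)
  linarith

lemma weight_le_one {m : ℕ} (hm : 1 ≤ m) {s : ℝ} (hs : s ∈ Icc (0 : ℝ) 2) : weight m s ≤ 1 := by
  have hm' : (1 : ℝ) ≤ m := mod_cast hm
  exact Real.rpow_le_one (mul_nonneg hs.1 (by linarith [hs.2]))
    (by linarith [sq_nonneg (s - 1)]) (by linarith)

lemma dilate_mem_Icc {r s : ℝ} (hr : 0 ≤ r) (hs : s ∈ Icc (0 : ℝ) 2) :
    r * s + (1 - r) ∈ Icc (1 - r) (1 + r) :=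
  ⟨by linarith [mul_nonneg hr hs.1], by linarith [mul_le_mul_of_nonneg_left hs.2 hr]⟩

lemma exists_norm_sub_dilate_le {E : Type*} [SeminormedAddCommGroup E] {f : ℝ → E}
    (hf : ContinuousOn f (Icc 0 2)) {ε : ℝ} (hε : 0 < ε) :
    ∃ r ∈ Ioo (0 : ℝ) 1, ∀ x ∈ Icc (0 : ℝ) 2, ‖f x - f (r * x + (1 - r))‖ ≤ ε := by
  obtain ⟨δ, hδ, hunif⟩ := Metric.uniformContinuousOn_iff_le.mp
    (isCompact_Icc.uniformContinuousOn_of_continuous hf) ε hε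
  have hmin : 0 < min δ (1 / 2) := by positivity
  have hr0 : 0 < 1 - min δ (1 / 2) := by linarith [min_le_right δ (1 / 2)]
  refine ⟨1 - min δ (1 / 2), ⟨hr0, by linarith⟩, fun x hx => ?_⟩
  rw [← dist_eq_norm]
  refine hunif x hx _ (Icc_subset_Icc (by linarith) (by linarith) (dilate_mem_Icc hr0.le hx)) ?_
  have hx1 : |x - 1| ≤ 1 := abs_le.mpr ⟨by linarith [hx.1], by linarith [hx.2]⟩
  calc dist x ((1 - min δ (1 / 2)) * x + (1 - (1 - min δ (1 / 2))))
      = min δ (1 / 2) * |x - 1| := by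
        rw [Real.dist_eq, ← abs_of_pos hmin, ← abs_mul, abs_of_pos hmin]
        congr 1
        ring
    _ ≤ δ := (mul_le_of_le_one_right hmin.le hx1).trans (min_le_left _ _)

/-- The dilation of `[0, 2]` by the factor `r` about its midpoint, as a polynomial. -/
def dilation (r : ℝ) : ℂ[X] := C (r : ℂ) * X + C ((1 - r : ℝ) : ℂ)

lemma derivative_dilation (r : ℝ) : derivative (dilation r) = C (r : ℂ) := by
  simp [dilation]

lemma eval_comp_dilation (q : ℂ[X]) (r s : ℝ) :
    (q.comp (dilation r)).eval (s : ℂ) = q.eval ((r * s + (1 - r) : ℝ) : ℂ) := by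
  simp [dilation]

lemma integral_dilate {E : Type*} [NormedAddCommGroup E] [NormedSpace ℝ E] (G : ℝ → E) {r : ℝ}
    (hr : 0 < r) :
    ∫ s in Ioo (0 : ℝ) 2, r • G (r * s + (1 - r)) = ∫ y in Icc (1 - r) (1 + r), G y := by
  rw [integral_Icc_eq_integral_Ioc, ← integral_Ioc_eq_integral_Ioo,
    ← intervalIntegral.integral_of_le zero_le_two,
    ← intervalIntegral.integral_of_le (by linarith), intervalIntegral.integral_smul,
    intervalIntegral.integral_comp_mul_add _ hr.ne', smul_inv_smul₀ hr.ne']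
  congr 1 <;> ring

lemma polySeminorm_comp_dilation_le {m : ℕ} (hm : 1 ≤ m) {r : ℝ} (hr : r ∈ Ioc (0 : ℝ) 1)
    (q : ℂ[X]) :
    polySeminorm m (q.comp (dilation r)) ≤
      √(∫ y in Icc (1 - r) (1 + r), ‖(derivative^[m] q).eval (y : ℂ)‖ ^ 2 * weight m y) := by
  have hdil : Continuous fun s : ℝ =>
      r • (‖(derivative^[m] q).eval ((r * s + (1 - r) : ℝ) : ℂ)‖ ^ 2 *
        weight m (r * s + (1 - r))) :=
    ((continuous_norm_eval_sq_mul_weight hm (derivative^[m] q)).comp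
      (by fun_prop : Continuous fun s : ℝ => r * s + (1 - r))).const_smul r
  rw [← integral_dilate _ hr.1]
  refine Real.sqrt_le_sqrt (setIntegral_mono_on
    ((continuous_norm_eval_sq_mul_weight hm _).integrableOn_Icc.mono_set Ioo_subset_Icc_self)
    (hdil.integrableOn_Icc.mono_set Ioo_subset_Icc_self)
    measurableSet_Ioo fun s hs => ?_)
  have hs' := Ioo_subset_Icc_self hs
  have hw := weight_le_weight_dilate hm (Ioc_subset_Icc_self hr) hs'
  have hrm : (r ^ m) ^ 2 ≤ r := by
    rw [← pow_mul]
    exact pow_le_of_le_one hr.1.le hr.2 (by omega)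
  simp only [iterate_derivative_comp_of_derivative_eq_C (derivative_dilation r), eval_C_mul,
    eval_comp_dilation]
  rw [norm_mul, norm_pow, Complex.norm_real, Real.norm_of_nonneg hr.1.le,
    mul_pow, mul_assoc, smul_eq_mul]
  have hw0 := weight_nonneg m hs'
  have hr0 := hr.1.le
  gcongr

lemma Icc_one_sub_one_add_subset_Ioo {r : ℝ} (hr : r < 1) :
    Icc (1 - r) (1 + r) ⊆ Ioo (0 : ℝ) 2 :=
  Icc_subset_Ioo (by linarith) (by linarith)

lemma IsAdmissible.memLp {m : ℕ} (hm : 1 ≤ m) {f : ℝ → ℂ} (hf : IsAdmissible m f) {r : ℝ}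
    (hr : r ∈ Ioo (0 : ℝ) 1) :
    MemLp (iteratedDeriv m f) 2 (volume.restrict (Icc (1 - r) (1 + r))) := by
  obtain ⟨n, rfl⟩ := Nat.exists_eq_add_of_le' hm
  have hmeas : StronglyMeasurable (iteratedDeriv (n + 1) f) := by
    rw [iteratedDeriv_succ]
    exact stronglyMeasurable_deriv _
  rw [memLp_two_iff_integrable_sq_norm hmeas.aestronglyMeasurable]
  obtain ⟨c, hc, hcw⟩ : ∃ c > 0, ∀ x ∈ Icc (1 - r) (1 + r), c ≤ weight (n + 1) x := by
    have hr2 : 0 < 1 - r ^ 2 := sub_pos.mpr (pow_lt_one₀ hr.1.le hr.2 two_ne_zero)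
    refine ⟨_, Real.rpow_pos_of_pos hr2 _, fun x hx => Real.rpow_le_rpow hr2.le ?_ ?_⟩
    · nlinarith [hx.1, hx.2]
    · push_cast
      linarith [(Nat.cast_nonneg n : (0 : ℝ) ≤ n)]
  refine ((hf.integrable.mono_set (Icc_one_sub_one_add_subset_Ioo hr.2)).const_mul c⁻¹).mono'
    (hmeas.norm.pow 2).aestronglyMeasurable
    ((ae_restrict_iff' measurableSet_Icc).mpr (Filter.Eventually.of_forall fun x hx => ?_))
  rw [Real.norm_of_nonneg (sq_nonneg _), ← div_eq_inv_mul, le_div_iff₀ hc]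
  gcongr
  exact hcw x hx

lemma sqrt_integral_norm_sq_mul_eq_lpNorm {α E : Type*} [MeasurableSpace α] {μ : Measure α}
    [NormedAddCommGroup E] [NormedSpace ℝ E] {w : α → ℝ} {u : α → E}
    (hwm : AEStronglyMeasurable w μ) (hw : ∀ᵐ x ∂μ, 0 ≤ w x) (hu : AEStronglyMeasurable u μ) :
    √(∫ x, ‖u x‖ ^ 2 * w x ∂μ) = lpNorm (fun x => √(w x) • u x) 2 μ := by
  rw [lpNorm_eq_integral_norm_rpow_toReal two_ne_zero ENNReal.ofNat_ne_top
    ((Real.continuous_sqrt.comp_aestronglyMeasurable hwm).fun_smul hu), Real.sqrt_eq_rpow,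
    ENNReal.toReal_ofNat, one_div]
  congr 1
  refine integral_congr_ae (hw.mono fun x hx => ?_)
  simp only [norm_smul, Real.norm_of_nonneg (Real.sqrt_nonneg _), Real.rpow_ofNat, mul_pow,
    Real.sq_sqrt hx, mul_comm]

lemma sqrt_integral_norm_sq_mul_le_add {α E : Type*} [MeasurableSpace α] {μ : Measure α}
    [NormedAddCommGroup E] [NormedSpace ℝ E] {w : α → ℝ} {u v : α → E}
    (hwm : AEStronglyMeasurable w μ) (hw : ∀ᵐ x ∂μ, w x ∈ Icc (0 : ℝ) 1) (hu : MemLp u 2 μ)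
    (hv : AEStronglyMeasurable v μ) {ε : ℝ} (hε : 0 ≤ ε)
    (huv : eLpNorm (fun x => u x - v x) 2 μ ≤ ENNReal.ofReal ε) :
    √(∫ x, ‖v x‖ ^ 2 * w x ∂μ) ≤ √(∫ x, ‖u x‖ ^ 2 * w x ∂μ) + ε := by
  have hw0 : ∀ᵐ x ∂μ, 0 ≤ w x := hw.mono fun x hx => hx.1
  have hsqrt := Real.continuous_sqrt.comp_aestronglyMeasurable hwm
  have hle : ∀ᵐ x ∂μ, ∀ y : E, ‖√(w x) • y‖ ≤ ‖y‖ := hw.mono fun x hx y => by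
    rw [norm_smul, Real.norm_of_nonneg (Real.sqrt_nonneg _)]
    exact mul_le_of_le_one_left (norm_nonneg _) (Real.sqrt_le_one.mpr hx.2)
  have hwu : MemLp (fun x => √(w x) • u x) 2 μ :=
    hu.of_le (hsqrt.fun_smul hu.1) (hle.mono fun x hx => hx _)
  rw [sqrt_integral_norm_sq_mul_eq_lpNorm hwm hw0 hu.1,
    sqrt_integral_norm_sq_mul_eq_lpNorm hwm hw0 hv]
  refine (lpNorm_le_lpNorm_add_lpNorm_sub hwu one_le_two).trans (add_le_add_right ?_ _)
  rw [← toReal_eLpNorm ((hsqrt.fun_smul hu.1).sub (hsqrt.fun_smul hv))]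
  refine ENNReal.toReal_le_of_le_ofReal hε (le_trans (eLpNorm_mono_ae ?_) huv)
  filter_upwards [hle] with x hx
  simpa only [Pi.sub_apply, smul_sub] using hx (u x - v x)

lemma sqrt_setIntegral_le_weightedNorm {m : ℕ} {g : ℝ → ℂ}
    (hg : IntegrableOn (fun s => ‖g s‖ ^ 2 * weight m s) (Ioo 0 2)) {s : Set ℝ}
    (hs : s ⊆ Ioo 0 2) : √(∫ x in s, ‖g x‖ ^ 2 * weight m x) ≤ weightedNorm m g := by
  refine Real.sqrt_le_sqrt (setIntegral_mono_set hg ?_ (LE.le.eventuallyLE hs))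
  refine (ae_restrict_iff' measurableSet_Ioo).mpr (Filter.Eventually.of_forall fun x hx => ?_)
  exact mul_nonneg (sq_nonneg _) (weight_nonneg m (Ioo_subset_Icc_self hx))

lemma IsAdmissible.exists_polynomial_on_Icc {m : ℕ} (hm : 1 ≤ m) {f : ℝ → ℂ}
    (hf : IsAdmissible m f) {r : ℝ} (hr : r ∈ Ioo (0 : ℝ) 1) {ε : ℝ} (hε : 0 < ε) :
    ∃ q : ℂ[X], (∀ x ∈ Icc (1 - r) (1 + r), ‖f x - q.eval (x : ℂ)‖ ≤ ε) ∧
      √(∫ y in Icc (1 - r) (1 + r), ‖(derivative^[m] q).eval (y : ℂ)‖ ^ 2 * weight m y) ≤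
        weightedNorm m (iteratedDeriv m f) + ε := by
  have hsub := Icc_one_sub_one_add_subset_Ioo hr.2
  have hmem := hf.memLp hm hr
  obtain ⟨n, rfl⟩ := Nat.exists_eq_add_of_le' hm
  obtain ⟨q, hsup, hnorm⟩ := exists_polynomial_approx_of_contDiffOn
    (by linarith [hr.1]) isOpen_Ioo hsub one_le_two ENNReal.ofNat_ne_top n hf.contDiffOn
    (hf.absCont _ _ (by linarith [hr.2]) (by linarith [hr.1]) (by linarith [hr.2])) hmem hε
  refine ⟨q, hsup, le_trans ?_ (add_le_add_left
    (sqrt_setIntegral_le_weightedNorm hf.integrable hsub) ε)⟩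
  refine sqrt_integral_norm_sq_mul_le_add (continuous_weight hm).aestronglyMeasurable
    ((ae_restrict_iff' measurableSet_Icc).mpr (Filter.Eventually.of_forall fun x hx => ?_))
    hmem (Continuous.aestronglyMeasurable (by fun_prop)) hε.le hnorm
  have hx' := Ioo_subset_Icc_self (hsub hx)
  exact ⟨weight_nonneg _ hx', weight_le_one hm hx'⟩

-- Dilating pulls the approximation problem away from the endpoints and does not increase
-- the weighted norms.
lemma IsAdmissible.exists_polynomial {m : ℕ} (hm : 1 ≤ m) {f : ℝ → ℂ} (hf : IsAdmissible m f)
    {ε : ℝ} (hε : 0 < ε) :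
    ∃ p : ℂ[X], (∀ x ∈ Icc (0 : ℝ) 2, ‖f x - p.eval (x : ℂ)‖ ≤ ε) ∧
      polySeminorm m p ≤ weightedNorm m (iteratedDeriv m f) + ε := by
  obtain ⟨r, hr, hdil⟩ := exists_norm_sub_dilate_le hf.continuousOn (half_pos hε)
  obtain ⟨q, hsup, hnorm⟩ := hf.exists_polynomial_on_Icc hm hr (half_pos hε)
  refine ⟨q.comp (dilation r), fun x hx => ?_, ?_⟩
  · rw [eval_comp_dilation]
    calc ‖f x - q.eval ((r * x + (1 - r) : ℝ) : ℂ)‖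
        ≤ ‖f x - f (r * x + (1 - r))‖ +
          ‖f (r * x + (1 - r)) - q.eval ((r * x + (1 - r) : ℝ) : ℂ)‖ :=
          norm_sub_le_norm_sub_add_norm_sub _ _ _
      _ ≤ ε / 2 + ε / 2 := add_le_add (hdil x hx) (hsup _ (dilate_mem_Icc hr.1.le hx))
      _ = ε := add_halves ε
  · calc polySeminorm m (q.comp (dilation r)) ≤ _ :=
          polySeminorm_comp_dilation_le hm (Ioo_subset_Ioc_self hr) q
      _ ≤ weightedNorm m (iteratedDeriv m f) + ε / 2 := hnorm
      _ ≤ weightedNorm m (iteratedDeriv m f) + ε := by linarith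

/-! ### The quadrature error of admissible functions -/

lemma node_mem_Icc (L ℓ : ℕ) : node L ℓ ∈ Icc (0 : ℝ) 2 :=
  ⟨by unfold node; linarith [Real.neg_one_le_cos (ℓ * Real.pi / L)],
    by unfold node; linarith [Real.cos_le_one (ℓ * Real.pi / L)]⟩

/-- The weight of the product rule `rule L z` at the node `node L ℓ`, obtained by integrating the
Lagrange basis polynomial of that node against the exponential. -/
def ruleWeight (L : ℕ) (z : ℂ) (ℓ : ℕ) : ℂ :=
  ∫ s in (0 : ℝ)..2, (Lagrange.basis (Finset.range (L + 1)) (fun ℓ => (node L ℓ : ℂ)) ℓ).eval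
    (s : ℂ) * Complex.exp (s * z)

lemma rule_eq_sum (L : ℕ) (z : ℂ) (f : ℝ → ℂ) :
    rule L z f = ∑ ℓ ∈ Finset.range (L + 1), f (node L ℓ) * ruleWeight L z ℓ := by
  simp only [rule, ruleWeight, interp, Lagrange.interpolate_apply]
  simp_rw [← intervalIntegral.integral_const_mul]
  rw [← intervalIntegral.integral_finsetSum]
  · refine intervalIntegral.integral_congr fun s _ => ?_
    simp only [eval_finsetSum, eval_mul, eval_C, Finset.sum_mul, mul_assoc]
  · exact fun ℓ _ => Continuous.intervalIntegrable (by fun_prop) _ _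

lemma norm_rule_sub_rule_le (L : ℕ) (z : ℂ) {f g : ℝ → ℂ} {ε : ℝ}
    (hfg : ∀ x ∈ Icc (0 : ℝ) 2, ‖f x - g x‖ ≤ ε) :
    ‖rule L z f - rule L z g‖ ≤ (∑ ℓ ∈ Finset.range (L + 1), ‖ruleWeight L z ℓ‖) * ε := by
  rw [rule_eq_sum, rule_eq_sum, ← Finset.sum_sub_distrib, Finset.sum_mul]
  refine norm_sum_le_of_le _ fun ℓ _ => ?_
  rw [← sub_mul, norm_mul, mul_comm]
  gcongr
  exact hfg _ (node_mem_Icc L ℓ)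

lemma norm_exactInt_sub_exactInt_le (z : ℂ) {f g : ℝ → ℂ} (hf : ContinuousOn f (Icc 0 2))
    (hg : ContinuousOn g (Icc 0 2)) {ε : ℝ} (hfg : ∀ x ∈ Icc (0 : ℝ) 2, ‖f x - g x‖ ≤ ε) :
    ‖exactInt z f - exactInt z g‖ ≤ (∫ s in (0 : ℝ)..2, ‖Complex.exp (s * z)‖) * ε := by
  have hexp : Continuous fun s : ℝ => Complex.exp (s * z) := by fun_prop
  have hint : ∀ f : ℝ → ℂ, ContinuousOn f (Icc 0 2) →
      IntervalIntegrable (fun s : ℝ => f s * Complex.exp (s * z)) volume 0 2 := fun f hf =>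
    ContinuousOn.intervalIntegrable_of_Icc zero_le_two (hf.mul hexp.continuousOn)
  rw [exactInt, exactInt, ← intervalIntegral.integral_sub (hint f hf) (hint g hg),
    ← intervalIntegral.integral_mul_const]
  refine intervalIntegral.norm_integral_le_of_norm_le zero_le_two
    (Filter.Eventually.of_forall fun s hs => ?_)
    ((hexp.norm.mul_const ε).intervalIntegrable _ _)
  rw [← sub_mul, norm_mul, mul_comm]
  gcongr
  exact hfg _ (Ioc_subset_Icc_self hs)

lemma exists_norm_quadError_sub_le (L : ℕ) (z : ℂ) :
    ∃ M : ℝ, ∀ {f g : ℝ → ℂ}, ContinuousOn f (Icc 0 2) → ContinuousOn g (Icc 0 2) →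
      ∀ {ε : ℝ}, (∀ x ∈ Icc (0 : ℝ) 2, ‖f x - g x‖ ≤ ε) →
        ‖quadError L z f - quadError L z g‖ ≤ M * ε := by
  refine ⟨(∑ ℓ ∈ Finset.range (L + 1), ‖ruleWeight L z ℓ‖) +
    ∫ s in (0 : ℝ)..2, ‖Complex.exp (s * z)‖, fun {f g} hf hg ε hfg => ?_⟩
  calc ‖quadError L z f - quadError L z g‖
      = ‖(rule L z f - rule L z g) - (exactInt z f - exactInt z g)‖ := by
        rw [quadError, quadError, sub_sub_sub_comm]
    _ ≤ _ := norm_sub_le_of_le (norm_rule_sub_rule_le L z hfg)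
        (norm_exactInt_sub_exactInt_le z hf hg hfg)
    _ = _ := (add_mul _ _ _).symm

lemma IsAdmissible.mul_norm_quadError_le {m L : ℕ} (hm : 1 ≤ m) {z : ℂ} {c B : ℝ} (hc : 0 ≤ c)
    (hB : 0 ≤ B) (hpoly : ∀ p : ℂ[X], c * ‖quadError L z (fun x : ℝ => p.eval (x : ℂ))‖ ≤
      B * polySeminorm m p) {f : ℝ → ℂ} (hf : IsAdmissible m f) :
    c * ‖quadError L z f‖ ≤ B * weightedNorm m (iteratedDeriv m f) := by
  obtain ⟨M, hM⟩ := exists_norm_quadError_sub_le L z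
  set W := weightedNorm m (iteratedDeriv m f)
  have hbound : ∀ ε > 0, c * ‖quadError L z f‖ ≤ B * (W + ε) + c * (M * ε) := by
    intro ε hε
    obtain ⟨p, hsup, hnorm⟩ := hf.exists_polynomial hm hε
    calc c * ‖quadError L z f‖
        ≤ c * (‖quadError L z (fun x : ℝ => p.eval (x : ℂ))‖ + M * ε) := by
          gcongr
          exact norm_le_norm_add_const_of_dist_le
            ((dist_eq_norm _ _).trans_le (hM hf.continuousOn (by fun_prop) hsup))
      _ ≤ B * (W + ε) + c * (M * ε) := by
          rw [mul_add]
          exact add_le_add_left ((hpoly p).trans (mul_le_mul_of_nonneg_left hnorm hB)) _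
  have hlim : Filter.Tendsto (fun ε : ℝ => B * (W + ε) + c * (M * ε)) (nhdsWithin 0 (Ioi 0))
      (nhds (B * (W + 0) + c * (M * 0))) :=
    (Continuous.tendsto (by fun_prop) 0).mono_left nhdsWithin_le_nhds
  simpa using ge_of_tendsto hlim (eventually_nhdsWithin_of_forall hbound)

section

variable {μ : ℝ} {L m : ℕ} {z : ℂ} {f : ℝ → ℂ}

lemma IsAdmissible.norm_quadError_le (hL : 0 < L) (hm : 1 ≤ m) (hmL : m ≤ L + 1) (hz : z.re ≤ μ)
    (hf : IsAdmissible m f) :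
    ‖quadError L z f‖ ≤ errorConst m μ * (L : ℝ) ^ (1 - (m : ℝ)) *
      (1 + |z.re|) ^ (-(3 / 4) : ℝ) * (1 / L) * weightedNorm m (iteratedDeriv m f) := by
  have hC := (errorConst_pos m μ).le
  simpa only [one_mul] using hf.mul_norm_quadError_le hm zero_le_one (by positivity)
    (by simpa only [one_mul] using norm_quadError_polynomial_le hL hm hmL hz)

lemma IsAdmissible.norm_quadError_le_of_ne_zero (hL : 0 < L) (hm : 1 ≤ m) (hmL : m ≤ L + 1)
    (hz : z.re ≤ μ) (hz0 : z ≠ 0) (hf : IsAdmissible m f) :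
    ‖quadError L z f‖ ≤ errorConst m μ * (L : ℝ) ^ (1 - (m : ℝ)) *
      (1 + |z.re|) ^ (-(3 / 4) : ℝ) * (1 / ‖z‖ * (1 + |z.re|) ^ (1 / 2 : ℝ)) *
        weightedNorm m (iteratedDeriv m f) := by
  have hC := (errorConst_pos m μ).le
  have h := hf.mul_norm_quadError_le hm (norm_nonneg z) (by positivity)
    (norm_mul_norm_quadError_polynomial_le hL hm hmL hz)
  rw [show (-(1 / 4) : ℝ) = -(3 / 4) + 1 / 2 by norm_num,
    Real.rpow_add (by positivity : 0 < 1 + |z.re|), mul_comm,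
    ← le_div_iff₀ (norm_pos_iff.mpr hz0)] at h
  exact h.trans_eq (by ring)

lemma IsAdmissible.norm_quadError_le_rpow {m₀ : ℝ} (hm₀ : 7 / 2 ≤ m₀) (hm : m₀ ≤ m) (hL : 0 < L)
    (hmL : m ≤ L + 1) (hz : z.re ≤ μ) (hf : IsAdmissible m f) :
    ‖quadError L z f‖ ≤ errorConst m μ * (1 + ‖z‖) ^ (-2 : ℝ) * (L : ℝ) ^ (m₀ - (m : ℝ) - 1) *
      (1 + (1 + |z.re|) ^ (-(1 / 2) : ℝ) * L) * weightedNorm m (iteratedDeriv m f) := by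
  have hm4 : 4 ≤ m := by
    have : (3 : ℝ) < m := by linarith
    exact_mod_cast this
  have hC := (errorConst_pos m μ).le
  have hz1 : 0 < 1 + ‖z‖ := by positivity
  have hN : 0 ≤ weightedNorm m (iteratedDeriv m f) := Real.sqrt_nonneg _
  have hpow : (L : ℝ) ^ (5 / 2 - (m : ℝ)) ≤ (L : ℝ) ^ (m₀ - (m : ℝ) - 1) :=
    Real.rpow_le_rpow_of_exponent_le (mod_cast hL) (by linarith)
  have h := hf.mul_norm_quadError_le (by omega) (by positivity) (by positivity)
    (sq_mul_norm_quadError_polynomial_le hL hm4 hmL hz)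
  rw [mul_comm, ← le_div_iff₀ (by positivity)] at h
  calc ‖quadError L z f‖ ≤ errorConst m μ * (1 + ‖z‖) ^ (-2 : ℝ) * (L : ℝ) ^ (5 / 2 - (m : ℝ)) *
        (1 + (1 + |z.re|) ^ (-(1 / 2) : ℝ) * L) * weightedNorm m (iteratedDeriv m f) := by
        rw [Real.rpow_neg hz1.le, Real.rpow_ofNat]
        exact h.trans_eq (by ring)
    _ ≤ _ := by gcongr

end

end

end ClenshawCurtis

theorem theorem3p1_general :
    (∀ (μ₀ : ℝ) (m : ℕ), 1 ≤ m →
      ∃ C : ℝ, 0 < C ∧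
        ∀ L : ℕ, 1 ≤ L → m ≤ L + 1 →
        ∀ z : ℂ, z.re ≤ μ₀ →
        ∀ f : ℝ → ℂ, ClenshawCurtis.IsAdmissible m f →
          ‖ClenshawCurtis.rule L z f - ClenshawCurtis.exactInt z f‖ ≤
            C * (L : ℝ) ^ (1 - (m : ℝ)) * (1 + |z.re|) ^ (-(3 / 4) : ℝ) *
              (if z = 0 then 1 / (L : ℝ)
                else min (1 / (L : ℝ)) (1 / ‖z‖ * (1 + |z.re|) ^ (1 / 2 : ℝ))) *
              ClenshawCurtis.weightedNorm m (iteratedDeriv m f)) ∧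
    (∀ (μ₀ : ℝ) (m : ℕ),
      ∃ C' : ℝ, 0 < C' ∧
        ∀ m₀ : ℝ, 7 / 2 ≤ m₀ → m₀ ≤ m →
        ∀ L : ℕ, 1 ≤ L → m ≤ L + 1 →
        ∀ z : ℂ, z.re ≤ μ₀ →
        ∀ f : ℝ → ℂ, ClenshawCurtis.IsAdmissible m f →
          ‖ClenshawCurtis.rule L z f - ClenshawCurtis.exactInt z f‖ ≤
            C' * (1 + ‖z‖) ^ (-2 : ℝ) * (L : ℝ) ^ (m₀ - (m : ℝ) - 1) *
              (1 + (1 + |z.re|) ^ (-(1 / 2) : ℝ) * (L : ℝ)) *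
              ClenshawCurtis.weightedNorm m (iteratedDeriv m f)) := by
  refine ⟨fun μ₀ m hm => ⟨_, ClenshawCurtis.errorConst_pos m μ₀, fun L hL hmL z hz f hf => ?_⟩,
    fun μ₀ m => ⟨_, ClenshawCurtis.errorConst_pos m μ₀, fun m₀ hm₀ hm L hL hmL z hz f hf =>
      hf.norm_quadError_le_rpow hm₀ hm hL hmL hz⟩⟩
  split_ifs with hz0
  · exact hf.norm_quadError_le hL hm hmL hz
  · rcases min_choice (1 / (L : ℝ)) (1 / ‖z‖ * (1 + |z.re|) ^ (1 / 2 : ℝ)) with h | h <;> rw [h]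
    exacts [hf.norm_quadError_le hL hm hmL hz, hf.norm_quadError_le_of_ne_zero hL hm hmL hz hz0]

theorem theorem3p1 :
    (∀ μ₀ : ℝ, 0 < μ₀ → ∀ m : ℕ, 1 ≤ m →
      ∃ C : ℝ, 0 < C ∧
        ∀ L : ℕ, 1 ≤ L → m ≤ L + 1 →
        ∀ z : ℂ, z.re ≤ μ₀ →
        ∀ f : ℝ → ℂ, ClenshawCurtis.IsAdmissible m f →
          ‖ClenshawCurtis.rule L z f - ClenshawCurtis.exactInt z f‖ ≤
            C * (L : ℝ) ^ (1 - (m : ℝ)) * (1 + |z.re|) ^ (-(3 / 4) : ℝ) *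
              -- for `z = 0` the second term of the minimum is infinite
              (if z = 0 then 1 / (L : ℝ)
                else min (1 / (L : ℝ)) (1 / ‖z‖ * (1 + |z.re|) ^ (1 / 2 : ℝ))) *
              ClenshawCurtis.weightedNorm m (iteratedDeriv m f)) ∧
    (∀ μ₀ : ℝ, 0 < μ₀ → ∀ (m : ℕ) (m₀ : ℝ), 7 / 2 < m₀ → m₀ ≤ m →
      ∃ C' : ℝ, 0 < C' ∧
        ∀ L : ℕ, 1 ≤ L → m ≤ L + 1 →
        ∀ z : ℂ, z.re ≤ μ₀ →
        ∀ f : ℝ → ℂ, ClenshawCurtis.IsAdmissible m f →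
          ‖ClenshawCurtis.rule L z f - ClenshawCurtis.exactInt z f‖ ≤
            C' * (1 + ‖z‖) ^ (-2 : ℝ) * (L : ℝ) ^ (m₀ - (m : ℝ) - 1) *
              (1 + (1 + |z.re|) ^ (-(1 / 2) : ℝ) * (L : ℝ)) *
              ClenshawCurtis.weightedNorm m (iteratedDeriv m f)) := by
  refine ⟨fun μ₀ _ => theorem3p1_general.1 μ₀, fun μ₀ _ m m₀ hm₀ hm => ?_⟩
  exact (theorem3p1_general.2 μ₀ m).imp fun _ h => ⟨h.1, h.2 m₀ hm₀.le hm⟩
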